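/- **Setting.** Images have $n_m = h\,w$ pixels ($h, w \ge 1$) on an $h\times w$ grid with periodic boundary conditions. Let $Y_h\in\mathbb R^{L_h\times n_h}$, $Y_m\in\mathbb R^{L_m\times n_m}$, $B\in\mathbb R^{n_m\times n_m}$, $R\in\mathbb R^{L_m\times L_h}$, $E\in\mathbb R^{L_h\times L_s}$ be arbitrary, let $M\in\{0,1\}^{n_m\times n_h}$ be a subsampling matrix (its columns are distinct columns of the identity), and let $\rho,\tau>0$, $\lambda\ge 0$. *Denoiser.* Let $n_p\ge1$, let $o_1,\dots,o_{n_p}$ be pixel offsets (the patch shape), and for every pixel $i$ let $P_i\in\{0,1\}^{n_p\times n_m}$ extract the patch $(i+o_t)_{t}$ (unit stride, periodic boundaries). Let $C_1,\dots,C_K\in\mathbb R^{n_p\times n_p}$ be symmetric positive semidefinite, and let $\beta_j^i\ge 0$ with $\sum_{j}\beta^i_j=1$ for every $i$. With $\sigma^2=\tau/\rho$ put $$W=\frac1{n_p}\sum_i P_i^T\Bigl(\sum_{j=1}^K\beta_j^i\,C_j(C_j+\sigma^2I)^{-1}\Bigr)P_i .$$ For the symmetric matrix $W$, let $\bar\Lambda$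 be the diagonal matrix of its nonzero eigenvalues, $\bar Q$ a matrix of corresponding orthonormal eigenvectors, and $\phi_W(x)=\frac12x^T\bar Q(\bar\Lambda^{-1}-I)\bar Q^Tx$ if $x$ lies in the column span of $W$, $\phi_W(x)=+\infty$ otherwise. For $X\in\mathbb R^{L_s\times n_m}$ with rows (bands) $x_1,\dots,x_{L_s}$ let $\phi_W(X)=\sum_\ell\phi_W(x_\ell)$. *Fusion problem.* For a regularizer $\phi$, consider $$\min_X\ \tfrac12\|EXBM-Y_h\|_F^2+\tfrac\lambda2\|REX-Y_m\|_F^2+\tau\,\phi(X).\qquad(\ast)$$ *Algorithm 1 (PnP-SALSA).* Start with $V_j^{(0)}=D_j^{(0)}=0$, $j=1,2,3$, and for $k\ge 0$ compute $$\begin{aligned} X^{(k+1)}&=\bigl[(V_1^{(k)}+D_1^{(k)})B^T+V_2^{(k)}+D_2^{(k)}+V_3^{(k)}+D_3^{(k)}\bigr](BB^T+2I)^{-1},\\ V_1^{(k+1)}&=\Bigl((E^TE+\rho I)^{-1}\bigl[E^TY_hM^T+\rho(X^{(k+1)}B-D_1^{(k)})\bigr]\Bigr)\odot\mathsf M+(X^{(k+1)}B-D_1^{(k)})\odot(1-\mathsf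 M),\\ V_2^{(k+1)}&=(\lambda E^TR^TRE+\rho I)^{-1}\bigl[\lambda E^TR^TY_m+\rho(X^{(k+1)}-D_2^{(k)})\bigr],\\ V_3^{(k+1)}&=(X^{(k+1)}-D_3^{(k)})\,W^T \quad\text{(the denoiser applied to each band)},\\ D_1^{(k+1)}&=D_1^{(k)}-(X^{(k+1)}B-V_1^{(k+1)}),\qquad D_j^{(k+1)}=D_j^{(k)}-(X^{(k+1)}-V_j^{(k+1)}),\ j=2,3, \end{aligned}$$ where $\odot$ is the entrywise product and $\mathsf M\in\{0,1\}^{L_s\times n_m}$ has ones exactly in the columns of the sampled pixels. **Statement.** Let $\phi=\frac{\rho}{\tau}\phi_W$. 1. Algorithm 1 is SALSA for $(\ast)$ with this $\phi$ and with $H_1=B^T\otimes I$, $H_2=H_3=I$: for every $k$, the above $X^{(k+1)},V_1^{(k+1)},V_2^{(k+1)},V_3^{(k+1)}$ are the unique minimizers of, respectively, $\|XB-V_1^{(k)}-D_1^{(k)}\|_F^2+\|X-V_2^{(k)}-D_2^{(k)}\|_F^2+\|X-V_3^{(k)}-D_3^{(k)}\|_F^2$ over $X$, $\|EVM-Y_h\|_F^2+\rho\|X^{(k+1)}B-V-D_1^{(k)}\|_F^2$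 over $V$, $\lambda\|REV-Y_m\|_F^2+\rho\|X^{(k+1)}-V-D_2^{(k)}\|_F^2$ over $V$, and $\phi(V)+\frac{\rho}{2\tau}\|X^{(k+1)}-V-D_3^{(k)}\|_F^2$ over $V$ (so that the GMM denoiser is the proximity operator of $\frac{\tau}{\rho}\phi=\phi_W$). 2. The problem $(\ast)$ has a solution, and so has $(\ast)$ with $\phi_W$ in place of $\phi$. 3. Algorithm 1 converges: there is a solution $X^*$ of $(\ast)$ such that, as $k\to\infty$, $X^{(k)}\to X^*$, the output $EX^{(k)}\to EX^*$, $V_1^{(k)}\to X^*B$, $V_2^{(k)}\to X^*$, $V_3^{(k)}\to X^*$, and $D_1^{(k)},D_2^{(k)},D_3^{(k)}$ converge. -/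

import Mathlib

open scoped Matrix Topology
open Filter

noncomputable section

/-- Pixels of an `h × w` image with periodic boundary conditions (indices taken modulo `h`, `w`). -/
abbrev Pixel (h w : ℕ) : Type := ZMod h × ZMod w

/-- Squared Frobenius norm. -/
def frobSq {m n : Type*} [Fintype m] [Fintype n] (A : Matrix m n ℝ) : ℝ :=
  ∑ i, ∑ j, A i j ^ 2

/-- `x = arg min f`: `x` is the unique global minimizer of `f`. -/
def IsArgmin {α β : Type*} [LT β] (f : α → β) (x : α) : Prop :=
  ∀ y, y ≠ x → f x < f y

section Denoiser

/-- Parameters of the scene-adapted (zero mean) Gaussian mixture: covariances `C_j` and, for every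
patch `i`, fixed posterior weights `β_j^i`. With unit stride and periodic boundaries there is one
patch per pixel, so that patches are indexed by pixels. -/
structure SceneGMM (h w np K : ℕ) where
  cov : Fin K → Matrix (Fin np) (Fin np) ℝ
  cov_posSemidef : ∀ j, (cov j).PosSemidef
  weight : Fin K → Pixel h w → ℝ
  weight_nonneg : ∀ j i, 0 ≤ weight j i
  weight_sum : ∀ i, ∑ j, weight j i = 1

variable {h w np K : ℕ}

/-- The binary matrix `P_i` extracting the patch at position `i`. The patch shape is the family `o`
of offsets, for instance an enumeration of `{0, …, a - 1} × {0, …, b - 1}` for `a × b` patches. -/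
def patchMatrix (o : Fin np → Pixel h w) (i : Pixel h w) :
    Matrix (Fin np) (Pixel h w) ℝ :=
  Matrix.of fun t q => if q = i + o t then 1 else 0

/-- `F_i = ∑ j, β_j^i C_j (C_j + σ² I)⁻¹`. -/
def patchFilter (g : SceneGMM h w np K) (σ2 : ℝ) (i : Pixel h w) :
    Matrix (Fin np) (Fin np) ℝ :=
  ∑ j, g.weight j i • (g.cov j * (g.cov j + σ2 • (1 : Matrix (Fin np) (Fin np) ℝ))⁻¹)

/-- The denoiser matrix `W = n_p⁻¹ ∑ i, P_iᵀ F_i P_i`. -/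
def gmmDenoiser [NeZero h] [NeZero w] (g : SceneGMM h w np K) (o : Fin np → Pixel h w)
    (σ2 : ℝ) : Matrix (Pixel h w) (Pixel h w) ℝ :=
  ((np : ℝ)⁻¹) • ∑ i, (patchMatrix o i)ᵀ * patchFilter g σ2 i * patchMatrix o i

theorem patchFilter_transpose (g : SceneGMM h w np K) (σ2 : ℝ) (i : Pixel h w) :
    (patchFilter g σ2 i)ᵀ = patchFilter g σ2 i := by
  unfold patchFilter
  rw [Matrix.transpose_sum]
  refine Finset.sum_congr rfl fun j _ => ?_
  have hC : (g.cov j)ᵀ = g.cov j := by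
    have := (g.cov_posSemidef j).isHermitian.eq
    rwa [Matrix.conjTranspose_eq_transpose_of_trivial] at this
  have hinv : g.cov j * (g.cov j + σ2 • (1 : Matrix (Fin np) (Fin np) ℝ))⁻¹ =
      (g.cov j + σ2 • (1 : Matrix (Fin np) (Fin np) ℝ))⁻¹ * g.cov j := by
    have hc : g.cov j * (g.cov j + σ2 • (1 : Matrix (Fin np) (Fin np) ℝ)) =
        (g.cov j + σ2 • (1 : Matrix (Fin np) (Fin np) ℝ)) * g.cov j := by
      simp [Matrix.mul_add, Matrix.add_mul]
    generalize g.cov j + σ2 • (1 : Matrix (Fin np) (Fin np) ℝ) = A at hc ⊢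
    by_cases hA : IsUnit A.det
    · calc g.cov j * A⁻¹ = A⁻¹ * (A * g.cov j) * A⁻¹ := by
            rw [← Matrix.mul_assoc, Matrix.nonsing_inv_mul A hA, Matrix.one_mul]
        _ = A⁻¹ * g.cov j := by
            rw [← hc, Matrix.mul_assoc, Matrix.mul_assoc, Matrix.mul_nonsing_inv A hA,
              Matrix.mul_one]
    · simp [Matrix.nonsing_inv_apply_not_isUnit A hA]
  rw [Matrix.transpose_smul, Matrix.transpose_mul, Matrix.transpose_nonsing_inv,
    Matrix.transpose_add, Matrix.transpose_smul, Matrix.transpose_one, hC, hinv]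

/-- `W` is symmetric, so that it has the eigendecomposition used below. -/
theorem gmmDenoiser_isHermitian [NeZero h] [NeZero w] (g : SceneGMM h w np K)
    (o : Fin np → Pixel h w) (σ2 : ℝ) : (gmmDenoiser g o σ2).IsHermitian := by
  unfold Matrix.IsHermitian
  rw [Matrix.conjTranspose_eq_transpose_of_trivial]
  unfold gmmDenoiser
  rw [Matrix.transpose_smul, Matrix.transpose_sum]
  congr 1
  refine Finset.sum_congr rfl fun i _ => ?_
  rw [Matrix.transpose_mul, Matrix.transpose_mul, Matrix.transpose_transpose,
    patchFilter_transpose, Matrix.mul_assoc]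

end Denoiser

section Regularizer

variable {ι : Type*} [Fintype ι] [DecidableEq ι]

open Classical in
/-- `φ_W(x) = ι_{S(W)}(x) + ½ xᵀ Q̄ (Λ̄⁻¹ - I) Q̄ᵀ x`, where `W = Q Λ Qᵀ`, only the nonzero
eigenvalues and their eigenvectors are kept in `Λ̄`, `Q̄`, and `S(W)` is the column span. -/
def phi (W : Matrix ι ι ℝ) (hW : W.IsHermitian) (x : ι → ℝ) : EReal :=
  if x ∈ LinearMap.range W.mulVecLin then
    (((1 / 2 : ℝ) * (x ⬝ᵥ
      (((hW.eigenvectorUnitary : Matrix ι ι ℝ) *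
        Matrix.diagonal (fun i => if hW.eigenvalues i = 0 then 0 else (hW.eigenvalues i)⁻¹ - 1) *
        (hW.eigenvectorUnitary : Matrix ι ι ℝ)ᵀ) *ᵥ x)) : ℝ) : EReal)
  else ⊤

/-- The function `φ_W` of a multi-band image (rows are bands, and `W` acts on each band). -/
def phiBands {L : Type*} [Fintype L] (W : Matrix ι ι ℝ) (hW : W.IsHermitian)
    (X : Matrix L ι ℝ) : EReal :=
  ∑ ℓ, phi W hW (X ℓ)

end Regularizer

section Fusion

/-- Data of a hyperspectral sharpening problem: observed images `Y_h`, `Y_m`, spatial blur `B`,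
subsampled pixels, spectral response `R`, subspace matrix `E`, parameters `ρ`, `λ`, `τ`. -/
structure FusionData (h w Lh Lm Ls nh : ℕ) where
  Yh : Matrix (Fin Lh) (Fin nh) ℝ
  Ym : Matrix (Fin Lm) (Pixel h w) ℝ
  B : Matrix (Pixel h w) (Pixel h w) ℝ
  sample : Fin nh ↪ Pixel h w
  R : Matrix (Fin Lm) (Fin Lh) ℝ
  E : Matrix (Fin Lh) (Fin Ls) ℝ
  rho : ℝ
  lam : ℝ
  tau : ℝ

/-- The variables `X`, `V_1`, `V_2`, `V_3`, `D_1`, `D_2`, `D_3` of the algorithm. -/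
structure SalsaState (h w Ls : ℕ) where
  X : Matrix (Fin Ls) (Pixel h w) ℝ
  V1 : Matrix (Fin Ls) (Pixel h w) ℝ
  V2 : Matrix (Fin Ls) (Pixel h w) ℝ
  V3 : Matrix (Fin Ls) (Pixel h w) ℝ
  D1 : Matrix (Fin Ls) (Pixel h w) ℝ
  D2 : Matrix (Fin Ls) (Pixel h w) ℝ
  D3 : Matrix (Fin Ls) (Pixel h w) ℝ

variable {h w Lh Lm Ls nh : ℕ} [NeZero h] [NeZero w]

namespace FusionData

/-- The spatial subsampling operator `M`, whose columns are columns of the identity. -/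
def M (d : FusionData h w Lh Lm Ls nh) : Matrix (Pixel h w) (Fin nh) ℝ :=
  Matrix.of fun q j => if q = d.sample j then 1 else 0

open Classical in
/-- The sampling mask: columns of ones at the sampled pixels, columns of zeros elsewhere. -/
def mask (d : FusionData h w Lh Lm Ls nh) : Matrix (Fin Ls) (Pixel h w) ℝ :=
  Matrix.of fun _ q => if q ∈ Set.range d.sample then 1 else 0

/-- `½ ‖E X B M - Y_h‖² + (λ / 2) ‖R E X - Y_m‖² + τ φ(X)`. -/
def objective (d : FusionData h w Lh Lm Ls nh) (φ : Matrix (Fin Ls) (Pixel h w) ℝ → EReal)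
    (X : Matrix (Fin Ls) (Pixel h w) ℝ) : EReal :=
  ((frobSq (d.E * X * d.B * d.M - d.Yh) / 2
    + d.lam * frobSq (d.R * d.E * X - d.Ym) / 2 : ℝ) : EReal) + (d.tau : EReal) * φ X

def xUpdate (d : FusionData h w Lh Lm Ls nh) (s : SalsaState h w Ls) :
    Matrix (Fin Ls) (Pixel h w) ℝ :=
  ((s.V1 + s.D1) * d.Bᵀ + s.V2 + s.D2 + s.V3 + s.D3) *
    (d.B * d.Bᵀ + (2 : ℝ) • (1 : Matrix (Pixel h w) (Pixel h w) ℝ))⁻¹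

/-- Here `Y_h` is brought to the full pixel grid by filling in zeros, that is, as `Y_h Mᵀ`. -/
def v1Update (d : FusionData h w Lh Lm Ls nh) (X D1 : Matrix (Fin Ls) (Pixel h w) ℝ) :
    Matrix (Fin Ls) (Pixel h w) ℝ :=
  Matrix.hadamard
      ((d.Eᵀ * d.E + d.rho • (1 : Matrix (Fin Ls) (Fin Ls) ℝ))⁻¹ *
        (d.Eᵀ * (d.Yh * d.Mᵀ) + d.rho • (X * d.B - D1)))
      d.mask
    + Matrix.hadamard (X * d.B - D1) (Matrix.of (fun _ _ => (1 : ℝ)) - d.mask)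

def v2Update (d : FusionData h w Lh Lm Ls nh) (X D2 : Matrix (Fin Ls) (Pixel h w) ℝ) :
    Matrix (Fin Ls) (Pixel h w) ℝ :=
  (d.lam • (d.Eᵀ * d.Rᵀ * d.R * d.E) + d.rho • (1 : Matrix (Fin Ls) (Fin Ls) ℝ))⁻¹ *
    (d.lam • (d.Eᵀ * d.Rᵀ * d.Ym) + d.rho • (X - D2))

/-- The denoiser `W` applied to each band (row) of `X - D_3`. -/
def v3Update (W : Matrix (Pixel h w) (Pixel h w) ℝ) (X D3 : Matrix (Fin Ls) (Pixel h w) ℝ) :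
    Matrix (Fin Ls) (Pixel h w) ℝ :=
  (X - D3) * Wᵀ

/-- One iteration of the algorithm. -/
def step (d : FusionData h w Lh Lm Ls nh) (W : Matrix (Pixel h w) (Pixel h w) ℝ)
    (s : SalsaState h w Ls) : SalsaState h w Ls :=
  let X := d.xUpdate s
  let V1 := d.v1Update X s.D1
  let V2 := d.v2Update X s.D2
  let V3 := v3Update W X s.D3
  { X := X
    V1 := V1
    V2 := V2
    V3 := V3
    D1 := s.D1 - (X * d.B - V1)
    D2 := s.D2 - (X - V2)
    D3 := s.D3 - (X - V3) }

/-- The iterates of PnP-SALSA, started at zero. The value of `X` at `k = 0` is never used. -/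
def iter (d : FusionData h w Lh Lm Ls nh) (W : Matrix (Pixel h w) (Pixel h w) ℝ) :
    ℕ → SalsaState h w Ls
  | 0 => { X := 0, V1 := 0, V2 := 0, V3 := 0, D1 := 0, D2 := 0, D3 := 0 }
  | k + 1 => d.step W (iter d W k)

/-- `t` is obtained from `s` by one exact SALSA iteration for the problem of minimizing
`d.objective φ`, with `H_1 = Bᵀ ⊗ I` and `H_2 = H_3 = I`. -/
structure IsSalsaStep (d : FusionData h w Lh Lm Ls nh)
    (φ : Matrix (Fin Ls) (Pixel h w) ℝ → EReal) (s t : SalsaState h w Ls) : Prop where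
  X_eq : IsArgmin (fun X : Matrix (Fin Ls) (Pixel h w) ℝ =>
    frobSq (X * d.B - s.V1 - s.D1) + frobSq (X - s.V2 - s.D2) + frobSq (X - s.V3 - s.D3)) t.X
  V1_eq : IsArgmin (fun V : Matrix (Fin Ls) (Pixel h w) ℝ =>
    frobSq (d.E * V * d.M - d.Yh) + d.rho * frobSq (t.X * d.B - V - s.D1)) t.V1
  V2_eq : IsArgmin (fun V : Matrix (Fin Ls) (Pixel h w) ℝ =>
    d.lam * frobSq (d.R * d.E * V - d.Ym) + d.rho * frobSq (t.X - V - s.D2)) t.V2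
  V3_eq : IsArgmin (fun V : Matrix (Fin Ls) (Pixel h w) ℝ =>
    φ V + ((d.rho / (2 * d.tau) * frobSq (t.X - V - s.D3) : ℝ) : EReal)) t.V3
  D1_eq : t.D1 = s.D1 - (t.X * d.B - t.V1)
  D2_eq : t.D2 = s.D2 - (t.X - t.V2)
  D3_eq : t.D3 = s.D3 - (t.X - t.V3)

end FusionData

end Fusion

end

/-! The denoiser enters only through two properties: `W` is symmetric and firmly nonexpansive, ‖Wz‖²
≤ z·Wz (`gmmDenoiser_firm`). Each Wiener filter C(C + σ²I)⁻¹ is firmly nonexpansive, and the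
property survives averaging over mixture components and over patches.

Firmness gives φ_W(Wz) = ½(z·Wz − ‖Wz‖²) ≥ 0 (`phi_mulVec`), so `W` is the proximity operator of φ_W
by expanding a quadratic (`isArgmin_phiBands`). The substitution X = ZW turns the extended-valued
fusion objective into a finite convex quadratic in Z. Its linear part vanishes on the radical of its
Hessian, so the stationarity equation is solvable without any coercivity (`exists_isCritical`), and
its solutions give minimizers (`IsCritical.isMinOn`).

For convergence, put p = (XB − D₁, X − D₂, X − D₃). The new V is prox(p) and the new D is V − p, so
the iteration is a Douglas-Rachford map acting on p alone (`drMap`). That map is firmly nonexpansive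
in the Frobenius norm (`drMap_firm`). A critical Z yields a fixed point
(`drMap_fixed_of_isCritical`), and a fixed point yields a solution (`fixed_point_spec`). Finite
dimension then makes p converge (`exists_tendsto_iterate_of_firmlyNonexpansive`), and continuity
carries this to all variables. -/

noncomputable section
-- Frobenius inner product and the Douglas-Rachford energy identity.
section Frobenius

variable {m n p : Type*} [Fintype m] [Fintype n] [Fintype p]

/-- The Frobenius inner product of two real matrices. -/
def frobInner (A B : Matrix m n ℝ) : ℝ := ∑ i, ∑ j, A i j * B i j

theorem frobInner_eq_trace (A B : Matrix m n ℝ) : frobInner A B = (Aᵀ * B).trace := by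
  simp only [frobInner, Matrix.trace, Matrix.diag, Matrix.mul_apply, Matrix.transpose_apply]
  exact Finset.sum_comm

theorem frobInner_self (A : Matrix m n ℝ) : frobInner A A = frobSq A := by
  simp only [frobInner, frobSq, sq]

theorem frobInner_comm (A B : Matrix m n ℝ) : frobInner A B = frobInner B A := by
  simp only [frobInner, mul_comm]

theorem frobInner_add_left (A B C : Matrix m n ℝ) :
    frobInner (A + B) C = frobInner A C + frobInner B C := by
  simp only [frobInner, Matrix.add_apply, add_mul, Finset.sum_add_distrib]

theorem frobInner_sub_left (A B C : Matrix m n ℝ) :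
    frobInner (A - B) C = frobInner A C - frobInner B C := by
  simp only [frobInner, Matrix.sub_apply, sub_mul, Finset.sum_sub_distrib]

theorem frobInner_smul_left (c : ℝ) (A B : Matrix m n ℝ) :
    frobInner (c • A) B = c * frobInner A B := by
  simp only [frobInner, Matrix.smul_apply, smul_eq_mul, mul_assoc, Finset.mul_sum]

theorem frobInner_add_right (A B C : Matrix m n ℝ) :
    frobInner A (B + C) = frobInner A B + frobInner A C := by
  simp only [frobInner_comm A, frobInner_add_left]

theorem frobInner_sub_right (A B C : Matrix m n ℝ) :
    frobInner A (B - C) = frobInner A B - frobInner A C := by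
  simp only [frobInner_comm A, frobInner_sub_left]

theorem frobInner_smul_right (c : ℝ) (A B : Matrix m n ℝ) :
    frobInner A (c • B) = c * frobInner A B := by
  simp only [frobInner_comm A, frobInner_smul_left]

theorem frobInner_zero_left (A : Matrix m n ℝ) : frobInner 0 A = 0 := by simp [frobInner]

theorem frobInner_zero_right (A : Matrix m n ℝ) : frobInner A 0 = 0 := by simp [frobInner]

theorem frobInner_mul_transpose_left (A : Matrix m n ℝ) (B : Matrix p n ℝ) (C : Matrix m p ℝ) :
    frobInner (A * Bᵀ) C = frobInner A (C * B) := by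
  rw [frobInner_eq_trace, frobInner_eq_trace, Matrix.transpose_mul, Matrix.transpose_transpose,
    Matrix.mul_assoc, Matrix.trace_mul_comm, Matrix.mul_assoc]

theorem frobInner_transpose_mul_left (A : Matrix m n ℝ) (B : Matrix m p ℝ) (C : Matrix p n ℝ) :
    frobInner (Bᵀ * A) C = frobInner A (B * C) := by
  rw [frobInner_eq_trace, frobInner_eq_trace, Matrix.transpose_mul, Matrix.transpose_transpose,
    Matrix.mul_assoc]

theorem frobSq_nonneg (A : Matrix m n ℝ) : 0 ≤ frobSq A :=
  Finset.sum_nonneg fun _ _ => Finset.sum_nonneg fun _ _ => sq_nonneg _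

theorem sq_apply_le_frobSq (A : Matrix m n ℝ) (i : m) (j : n) : A i j ^ 2 ≤ frobSq A :=
  (Finset.single_le_sum (f := fun j => A i j ^ 2) (fun _ _ => sq_nonneg _)
    (Finset.mem_univ j)).trans
  (Finset.single_le_sum (f := fun i => ∑ j, A i j ^ 2)
    (fun _ _ => Finset.sum_nonneg fun _ _ => sq_nonneg _) (Finset.mem_univ i))

theorem frobSq_eq_zero {A : Matrix m n ℝ} : frobSq A = 0 ↔ A = 0 := by
  refine ⟨fun h => ?_, fun h => by simp [h, frobSq]⟩
  ext i j
  have := sq_apply_le_frobSq A i j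
  rw [h] at this
  simpa using le_antisymm this (sq_nonneg _)

theorem frobSq_pos {A : Matrix m n ℝ} (h : A ≠ 0) : 0 < frobSq A :=
  (frobSq_nonneg A).lt_of_ne fun h' => h (frobSq_eq_zero.1 h'.symm)

theorem frobSq_add (A B : Matrix m n ℝ) :
    frobSq (A + B) = frobSq A + 2 * frobInner A B + frobSq B := by
  simp only [← frobInner_self, frobInner_add_left, frobInner_add_right, frobInner_comm B A]
  ring

theorem eq_zero_of_forall_frobInner {A : Matrix m n ℝ} (h : ∀ U, frobInner A U = 0) : A = 0 :=
  frobSq_eq_zero.1 (by rw [← frobInner_self, h])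

theorem continuous_frobSq : Continuous (frobSq : Matrix m n ℝ → ℝ) := by
  unfold frobSq
  fun_prop

/-- The Douglas-Rachford energy identity, for the step from `w` to `b + w - a`. -/
theorem frobSq_douglasRachford (w a b : Matrix m n ℝ) :
    frobSq (b + w - a) + frobSq (a - b) =
      frobSq w - 2 * frobInner a (w - a) - 2 * frobInner b (a + (a - w) - b) := by
  simp only [← frobInner_self, frobInner_add_left, frobInner_add_right, frobInner_sub_left,
    frobInner_sub_right, frobInner_comm b a, frobInner_comm w a, frobInner_comm b w]
  ring

end Frobenius

/-! ### Convergence of iterates of firmly nonexpansive maps. -/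

section FirmlyNonexpansive

/-- The iterates of a map which is firmly nonexpansive with respect to a function `q` dominating
the norm converge to a fixed point, as soon as there is one. -/
theorem exists_tendsto_iterate_of_firmlyNonexpansive {E : Type*} [NormedAddCommGroup E]
    [ProperSpace E] {q : E → ℝ} (hq : Continuous q) (hq0 : q 0 = 0) (hle : ∀ x, ‖x‖ ^ 2 ≤ q x)
    {T : E → E} (hT : ∀ x y, q (T x - T y) + q ((x - T x) - (y - T y)) ≤ q (x - y))
    {p : E} (hp : T p = p) (x : E) :
    ∃ z, T z = z ∧ Tendsto (fun k => T^[k] x) atTop (𝓝 z) := by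
  have hq_nonneg : ∀ y, 0 ≤ q y := fun y => (sq_nonneg _).trans (hle y)
  have hfix : ∀ z, T z = z → ∀ k,
      q (T^[k+1] x - z) + q (T^[k] x - T^[k+1] x) ≤ q (T^[k] x - z) := by
    intro z hz k
    have := hT (T^[k] x) z
    rw [hz, sub_self, sub_zero] at this
    rwa [Function.iterate_succ_apply']
  have hanti : ∀ z, T z = z → Antitone fun k => q (T^[k] x - z) := fun z hz =>
    antitone_nat_of_succ_le fun k => by linarith [hfix z hz k, hq_nonneg (T^[k] x - T^[k+1] x)]
  have hnorm : ∀ {u : ℕ → E}, Tendsto (fun k => q (u k)) atTop (𝓝 0) → Tendsto u atTop (𝓝 0) := by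
    intro u hu
    rw [tendsto_zero_iff_norm_tendsto_zero]
    have h2 : Tendsto (fun k => ‖u k‖ ^ 2) atTop (𝓝 0) :=
      squeeze_zero (fun _ => sq_nonneg _) (fun _ => hle _) hu
    simpa using h2.sqrt
  have hconv : ∀ z, T z = z → ∃ l, Tendsto (fun k => q (T^[k] x - z)) atTop (𝓝 l) := fun z hz =>
    ⟨_, tendsto_atTop_ciInf (hanti z hz) ⟨0, by rintro _ ⟨k, rfl⟩; exact hq_nonneg _⟩⟩
  -- Successive differences are bounded by the decrements of a convergent sequence.
  have hdiff : Tendsto (fun k => T^[k] x - T^[k+1] x) atTop (𝓝 0) := by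
    obtain ⟨l, hl⟩ := hconv p hp
    refine hnorm (squeeze_zero (fun _ => hq_nonneg _)
      (fun k => le_sub_iff_add_le'.2 (hfix p hp k)) ?_)
    simpa using hl.sub (hl.comp (tendsto_add_atTop_nat 1))
  have hTcont : Continuous T := by
    refine continuous_iff_continuousAt.2 fun y => ?_
    have h0 : Tendsto (fun u => q (u - y)) (𝓝 y) (𝓝 0) := by
      have : Continuous fun u => q (u - y) := by fun_prop
      simpa [hq0] using this.tendsto y
    have h1 : Tendsto (fun u => ‖T u - T y‖ ^ 2) (𝓝 y) (𝓝 0) :=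
      squeeze_zero (fun _ => sq_nonneg _)
        (fun u => by linarith [hle (T u - T y), hT u y, hq_nonneg ((u - T u) - (y - T y))]) h0
    exact tendsto_iff_norm_sub_tendsto_zero.2 (by simpa using h1.sqrt)
  -- The orbit stays in a ball around `p`, so it has a cluster point; vanishing differences and
  -- continuity make it a fixed point.
  obtain ⟨z, -, ψ, hψ, hz⟩ := (isCompact_closedBall p (Real.sqrt (q (x - p)))).tendsto_subseq
    (x := fun k => T^[k] x) fun k => by
      rw [Metric.mem_closedBall, dist_eq_norm]
      exact Real.le_sqrt_of_sq_le ((hle _).trans (hanti p hp (Nat.zero_le k)))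
  have hTz : T z = z := by
    have h1 := hz.sub (hdiff.comp hψ.tendsto_atTop)
    have h2 := (hTcont.tendsto z).comp hz
    refine tendsto_nhds_unique h2 ?_
    convert h1 using 2 with k
    · simp [Function.iterate_succ_apply']
    · simp
  refine ⟨z, hTz, ?_⟩
  obtain ⟨l, hl⟩ := hconv z hTz
  -- The energy relative to `z` converges along the whole sequence and tends to 0 along the
  -- subsequence.
  have hl0 : l = 0 := by
    have h1 := hl.comp hψ.tendsto_atTop
    have h2 : Continuous fun u => q (u - z) := by fun_prop
    have h3 := (h2.tendsto z).comp hz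
    simp only [sub_self, hq0] at h3
    exact tendsto_nhds_unique h1 h3
  rw [hl0] at hl
  simpa using (hnorm hl).add_const z

end FirmlyNonexpansive

/-! ### Solvability of symmetric linear systems. -/

section SymmetricForm

/-- For a symmetric bilinear form on a finite-dimensional space, every functional that vanishes
on the radical is represented by the form. -/
theorem exists_eq_of_vanishes_on_ker {𝕜 V : Type*} [Field 𝕜] [AddCommGroup V] [Module 𝕜 V]
    [FiniteDimensional 𝕜 V] (β : V →ₗ[𝕜] V →ₗ[𝕜] 𝕜) (hβ : ∀ x y, β x y = β y x)
    (f : V →ₗ[𝕜] 𝕜) (hf : ∀ x, β x = 0 → f x = 0) : ∃ z, β z = f := by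
  -- The range of the transpose is the annihilator of the kernel; by reflexivity and symmetry the
  -- transpose is `β` itself.
  have hmem : f ∈ LinearMap.range (LinearMap.dualMap (β : V →ₗ[𝕜] Module.Dual 𝕜 V)) := by
    rw [LinearMap.range_dualMap_eq_dualAnnihilator_ker, Submodule.mem_dualAnnihilator]
    exact fun x hx => hf x hx
  obtain ⟨Φ, hΦ⟩ := hmem
  obtain ⟨v, rfl⟩ := (Module.evalEquiv 𝕜 V).surjective Φ
  refine ⟨v, ?_⟩
  rw [← hΦ]
  ext y
  simp [hβ v y]

end SymmetricForm
end

noncomputable section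
-- Firm nonexpansiveness of the patch denoiser.
section Firmness

variable {ι : Type*} [Fintype ι]

theorem dotProduct_le_half {κ : Type*} [Fintype κ] (v a : κ → ℝ) :
    v ⬝ᵥ a ≤ (v ⬝ᵥ v + a ⬝ᵥ a) / 2 := by
  simp only [dotProduct, ← Finset.sum_add_distrib, Finset.sum_div]
  exact Finset.sum_le_sum fun i _ => by nlinarith [sq_nonneg (v i - a i)]

theorem isUnit_det_of_posDef [DecidableEq ι] {A : Matrix ι ι ℝ} (hA : A.PosDef) :
    IsUnit A.det := hA.det_pos.ne'.isUnit

omit [Fintype ι] in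
theorem posDef_smul_one [DecidableEq ι] {c : ℝ} (hc : 0 < c) :
    (c • (1 : Matrix ι ι ℝ)).PosDef := Matrix.PosDef.one.smul hc

/-- With y = (C + σ²I)u one has Fy = Cu, so y·Fy − Fy·Fy = σ² u·Cu ≥ 0. -/
theorem wiener_firm [DecidableEq ι] {C : Matrix ι ι ℝ} (hC : C.PosSemidef) {σ2 : ℝ} (hσ : 0 < σ2)
    (y : ι → ℝ) :
    let F := C * (C + σ2 • (1 : Matrix ι ι ℝ))⁻¹
    (F *ᵥ y) ⬝ᵥ (F *ᵥ y) ≤ y ⬝ᵥ (F *ᵥ y) := by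
  intro F
  have hU := isUnit_det_of_posDef (Matrix.PosDef.posSemidef_add hC (posDef_smul_one (ι := ι) hσ))
  set u := (C + σ2 • (1 : Matrix ι ι ℝ))⁻¹ *ᵥ y with hu
  have hF : F *ᵥ y = C *ᵥ u := by simp [F, hu, Matrix.mulVec_mulVec]
  have hy : y = C *ᵥ u + σ2 • u := by
    have : (C + σ2 • (1 : Matrix ι ι ℝ)) *ᵥ u = y := by
      rw [hu, Matrix.mulVec_mulVec, Matrix.mul_nonsing_inv _ hU, Matrix.one_mulVec]
    rw [← this, Matrix.add_mulVec, Matrix.smul_mulVec, Matrix.one_mulVec]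
  have hpos : 0 ≤ u ⬝ᵥ (C *ᵥ u) := by simpa using hC.dotProduct_mulVec_nonneg u
  rw [hF, hy, add_dotProduct, smul_dotProduct]
  have := mul_nonneg hσ.le hpos
  simpa using this

variable {h w np K : ℕ}

/-- Firmness survives convex combinations: v·v is the average of v·F_j y, each at most (v·v + F_j
y·F_j y)/2 ≤ (v·v + y·F_j y)/2. Averaging gives v·v ≤ (v·v + y·v)/2. -/
theorem patchFilter_firm (g : SceneGMM h w np K) {σ2 : ℝ} (hσ : 0 < σ2) (i : Pixel h w)
    (y : Fin np → ℝ) :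
    (patchFilter g σ2 i *ᵥ y) ⬝ᵥ (patchFilter g σ2 i *ᵥ y) ≤ y ⬝ᵥ (patchFilter g σ2 i *ᵥ y) := by
  set F : Fin K → Matrix (Fin np) (Fin np) ℝ := fun j =>
    g.cov j * (g.cov j + σ2 • (1 : Matrix (Fin np) (Fin np) ℝ))⁻¹ with hF
  set v := patchFilter g σ2 i *ᵥ y with hv
  have hsum : ∀ u : Fin np → ℝ, u ⬝ᵥ v = ∑ j, g.weight j i * (u ⬝ᵥ (F j *ᵥ y)) := by
    intro u
    rw [hv, patchFilter, Matrix.sum_mulVec, dotProduct_sum]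
    exact Finset.sum_congr rfl fun j _ => by rw [Matrix.smul_mulVec, dotProduct_smul, smul_eq_mul]
  have h1 : v ⬝ᵥ v ≤ ∑ j, g.weight j i * ((v ⬝ᵥ v + y ⬝ᵥ (F j *ᵥ y)) / 2) := by
    conv_lhs => rw [hsum v]
    refine Finset.sum_le_sum fun j _ => mul_le_mul_of_nonneg_left ?_ (g.weight_nonneg j i)
    have := wiener_firm (g.cov_posSemidef j) hσ y
    exact (dotProduct_le_half _ _).trans (by simp only [hF]; linarith)
  have h2 : ∑ j, g.weight j i * ((v ⬝ᵥ v + y ⬝ᵥ (F j *ᵥ y)) / 2) = (v ⬝ᵥ v + y ⬝ᵥ v) / 2 := by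
    rw [hsum y]
    calc _ = (∑ j, g.weight j i) * (v ⬝ᵥ v / 2)
        + (∑ j, g.weight j i * (y ⬝ᵥ (F j *ᵥ y))) / 2 := by
          rw [Finset.sum_mul, Finset.sum_div, ← Finset.sum_add_distrib]
          exact Finset.sum_congr rfl fun j _ => by ring
      _ = _ := by rw [g.weight_sum]; ring
  linarith

variable [NeZero h] [NeZero w]

theorem patchMatrix_mulVec (o : Fin np → Pixel h w) (i : Pixel h w) (v : Pixel h w → ℝ)
    (t : Fin np) : (patchMatrix o i *ᵥ v) t = v (i + o t) := by
  simp [patchMatrix, Matrix.mulVec, dotProduct]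

/-- For each offset, translation permutes the periodic grid, so each of the `np` patch entries
contributes the full energy once. -/
theorem sum_patch_energy (o : Fin np → Pixel h w) (v : Pixel h w → ℝ) :
    ∑ i, (patchMatrix o i *ᵥ v) ⬝ᵥ (patchMatrix o i *ᵥ v) = np * (v ⬝ᵥ v) := by
  simp only [dotProduct, patchMatrix_mulVec]
  rw [Finset.sum_comm]
  have : ∀ t : Fin np, ∑ i, v (i + o t) * v (i + o t) = ∑ i, v i * v i := fun t =>
    Equiv.sum_comp (Equiv.addRight (o t)) fun i => v i * v i
  simp [this]

/-- The denoiser is firmly nonexpansive: its spectrum lies in `[0, 1]`. -/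
theorem gmmDenoiser_firm [NeZero np] (g : SceneGMM h w np K) (o : Fin np → Pixel h w)
    {σ2 : ℝ} (hσ : 0 < σ2) (z : Pixel h w → ℝ) :
    (gmmDenoiser g o σ2 *ᵥ z) ⬝ᵥ (gmmDenoiser g o σ2 *ᵥ z) ≤ z ⬝ᵥ (gmmDenoiser g o σ2 *ᵥ z) := by
  have hnp : (0 : ℝ) < np := Nat.cast_pos.2 (NeZero.pos np)
  set v := gmmDenoiser g o σ2 *ᵥ z with hv
  set a : Pixel h w → Fin np → ℝ := fun i => patchFilter g σ2 i *ᵥ (patchMatrix o i *ᵥ z) with ha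
  have hsum : ∀ u : Pixel h w → ℝ,
      np * (u ⬝ᵥ v) = ∑ i, (patchMatrix o i *ᵥ u) ⬝ᵥ a i := by
    intro u
    rw [hv, gmmDenoiser, Matrix.smul_mulVec, dotProduct_smul, smul_eq_mul,
      mul_inv_cancel_left₀ hnp.ne', Matrix.sum_mulVec, dotProduct_sum]
    refine Finset.sum_congr rfl fun i _ => ?_
    rw [Matrix.mul_assoc, ← Matrix.mulVec_mulVec, Matrix.dotProduct_mulVec, Matrix.vecMul_transpose,
      ← Matrix.mulVec_mulVec]
  -- The averaging argument of `patchFilter_firm` again, now over patches, with total weight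
  -- supplied by `sum_patch_energy`.
  have h1 : np * (v ⬝ᵥ v) ≤ (np * (v ⬝ᵥ v) + np * (z ⬝ᵥ v)) / 2 := by
    conv_lhs => rw [hsum v]
    rw [hsum z, ← sum_patch_energy o v, ← Finset.sum_add_distrib, Finset.sum_div]
    refine Finset.sum_le_sum fun i _ => (dotProduct_le_half _ _).trans ?_
    have := patchFilter_firm g hσ i (patchMatrix o i *ᵥ z)
    simp only [ha]
    linarith
  nlinarith

end Firmness

/-! ### The regularizer on the range of `W`. -/

section Regularizer

variable {ι L : Type*} [Fintype ι] [DecidableEq ι] [Fintype L]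

/-- Removes the eigendecomposition: the middle matrix G satisfies WGW = W − W², because λ(λ⁻¹ − 1)λ
= λ − λ² for λ ≠ 0 and both sides vanish at λ = 0. -/
theorem phi_mulVec {W : Matrix ι ι ℝ} (hW : W.IsHermitian) (z : ι → ℝ) :
    phi W hW (W *ᵥ z) = (((z ⬝ᵥ (W *ᵥ z) - (W *ᵥ z) ⬝ᵥ (W *ᵥ z)) / 2 : ℝ) : EReal) := by
  have hT : Wᵀ = W := by rwa [← Matrix.conjTranspose_eq_transpose_of_trivial]
  rw [phi, if_pos ⟨z, rfl⟩]
  congr 1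
  set Q := (hW.eigenvectorUnitary : Matrix ι ι ℝ) with hQ
  set G := Q * Matrix.diagonal
    (fun i => if hW.eigenvalues i = 0 then 0 else (hW.eigenvalues i)⁻¹ - 1) * Qᵀ with hG
  have hQQ : Qᵀ * Q = 1 := by
    have := Matrix.mem_unitaryGroup_iff'.1 hW.eigenvectorUnitary.2
    rwa [Matrix.star_eq_conjTranspose, Matrix.conjTranspose_eq_transpose_of_trivial] at this
  have hspec : W = Q * Matrix.diagonal hW.eigenvalues * Qᵀ := by
    have := hW.spectral_theorem
    rw [Unitary.conjStarAlgAut_apply] at this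
    rwa [Matrix.star_eq_conjTranspose, Matrix.conjTranspose_eq_transpose_of_trivial] at this
  have key : W * G * W = W - W * W := by
    have hmul : ∀ D D' : ι → ℝ, Q * Matrix.diagonal D * Qᵀ * (Q * Matrix.diagonal D' * Qᵀ) =
        Q * Matrix.diagonal (D * D') * Qᵀ := by
      intro D D'
      calc _ = Q * Matrix.diagonal D * (Qᵀ * Q) * Matrix.diagonal D' * Qᵀ := by
            simp only [Matrix.mul_assoc]
        _ = _ := by
            rw [hQQ, Matrix.mul_one, Matrix.mul_assoc Q, Matrix.diagonal_mul_diagonal]; rfl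
    rw [hspec, hG]
    simp only [hmul, ← Matrix.mul_sub, ← Matrix.sub_mul, Matrix.diagonal_sub]
    congr 3
    ext i
    by_cases hi : hW.eigenvalues i = 0 <;> simp [hi]
    field_simp
  clear_value G
  have h1 : (W *ᵥ z) ⬝ᵥ (G *ᵥ (W *ᵥ z)) = z ⬝ᵥ (W *ᵥ z) - (W *ᵥ z) ⬝ᵥ (W *ᵥ z) := by
    have hsymm : ∀ x y : ι → ℝ, (W *ᵥ x) ⬝ᵥ y = x ⬝ᵥ (W *ᵥ y) := fun x y => by
      rw [Matrix.dotProduct_mulVec, ← Matrix.mulVec_transpose, hT]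
    rw [hsymm, hsymm, Matrix.mulVec_mulVec, Matrix.mulVec_mulVec, Matrix.mulVec_mulVec,
      key, Matrix.sub_mulVec, dotProduct_sub]
  rw [h1]
  ring

theorem phi_nonneg {W : Matrix ι ι ℝ} (hW : W.IsHermitian)
    (hfirm : ∀ z, (W *ᵥ z) ⬝ᵥ (W *ᵥ z) ≤ z ⬝ᵥ (W *ᵥ z)) (x : ι → ℝ) : 0 ≤ phi W hW x := by
  by_cases hx : x ∈ LinearMap.range W.mulVecLin
  · obtain ⟨z, rfl⟩ := hx
    rw [Matrix.mulVecLin_apply, phi_mulVec]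
    exact_mod_cast div_nonneg (sub_nonneg.2 (hfirm z)) zero_le_two
  · rw [phi, if_neg hx]
    exact le_top

omit [DecidableEq ι] [Fintype L] in
theorem mul_row_eq_mulVec {W : Matrix ι ι ℝ} (hT : Wᵀ = W) (Z : Matrix L ι ℝ) (ℓ : L) :
    (Z * W) ℓ = W *ᵥ Z ℓ := by
  conv_rhs => rw [← hT, Matrix.mulVec_transpose]
  rfl

theorem ereal_coe_sum {κ : Type*} (s : Finset κ) (f : κ → ℝ) :
    ∑ i ∈ s, (f i : EReal) = ((∑ i ∈ s, f i : ℝ) : EReal) :=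
  (map_sum (⟨⟨Real.toEReal, EReal.coe_zero⟩, EReal.coe_add⟩ : ℝ →+ EReal) f s).symm

theorem phiBands_mul {W : Matrix ι ι ℝ} (hW : W.IsHermitian) (Z : Matrix L ι ℝ) :
    phiBands W hW (Z * W) = (((frobInner Z (Z * W) - frobSq (Z * W)) / 2 : ℝ) : EReal) := by
  have hT : Wᵀ = W := by rwa [← Matrix.conjTranspose_eq_transpose_of_trivial]
  simp only [phiBands, mul_row_eq_mulVec hT, phi_mulVec]
  rw [ereal_coe_sum, ← Finset.sum_div, Finset.sum_sub_distrib, ← frobInner_self]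
  congr 3 <;> (refine Finset.sum_congr rfl fun ℓ _ => ?_) <;>
    simp only [dotProduct, ← mul_row_eq_mulVec hT]

/-- A single band outside the range suffices, since nonnegativity of the other summands keeps the
sum at `⊤`. -/
theorem phiBands_eq_top {W : Matrix ι ι ℝ} (hW : W.IsHermitian)
    (hfirm : ∀ z, (W *ᵥ z) ⬝ᵥ (W *ᵥ z) ≤ z ⬝ᵥ (W *ᵥ z)) {X : Matrix L ι ℝ}
    (hX : ¬ ∃ Z : Matrix L ι ℝ, X = Z * W) : phiBands W hW X = ⊤ := by
  have hT : Wᵀ = W := by rwa [← Matrix.conjTranspose_eq_transpose_of_trivial]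
  obtain ⟨ℓ, hℓ⟩ : ∃ ℓ, X ℓ ∉ LinearMap.range W.mulVecLin := by
    by_contra! hall
    choose Z hZ using hall
    refine hX ⟨Matrix.of Z, ?_⟩
    exact funext fun ℓ => (hZ ℓ).symm.trans (mul_row_eq_mulVec hT (Matrix.of Z) ℓ).symm
  have hle := Finset.single_le_sum (f := fun ℓ => phi W hW (X ℓ))
    (fun ℓ _ => phi_nonneg hW hfirm (X ℓ)) (Finset.mem_univ ℓ)
  rw [show phi W hW (X ℓ) = ⊤ from if_neg hℓ] at hle
  exact top_le_iff.1 hle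

omit [DecidableEq ι] in
theorem frobSq_mul_le {W : Matrix ι ι ℝ} (hW : W.IsHermitian)
    (hfirm : ∀ z, (W *ᵥ z) ⬝ᵥ (W *ᵥ z) ≤ z ⬝ᵥ (W *ᵥ z)) (Z : Matrix L ι ℝ) :
    frobSq (Z * W) ≤ frobInner Z (Z * W) := by
  have hT : Wᵀ = W := by rwa [← Matrix.conjTranspose_eq_transpose_of_trivial]
  rw [← frobInner_self]
  refine Finset.sum_le_sum fun ℓ _ => ?_
  have := hfirm (Z ℓ)
  rwa [← mul_row_eq_mulVec hT] at this

end Regularizer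
end

noncomputable section
namespace FusionData

variable {h w Lh Lm Ls nh : ℕ} [NeZero h] [NeZero w]

/-! ### Normal equations of the updates. -/

section Updates

theorem M_transpose_mul_M (d : FusionData h w Lh Lm Ls nh) : d.Mᵀ * d.M = 1 := by
  ext i j
  simp [M, Matrix.mul_apply, Matrix.one_apply, eq_comm]

/-- Masking is right multiplication by the projection MMᵀ, which makes the first update accessible
to matrix algebra. -/
theorem hadamard_mask (d : FusionData h w Lh Lm Ls nh) (A : Matrix (Fin Ls) (Pixel h w) ℝ) :
    Matrix.hadamard A d.mask = A * (d.M * d.Mᵀ) := by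
  classical
  have hdiag : d.M * d.Mᵀ =
      Matrix.diagonal fun q => if q ∈ Set.range d.sample then (1 : ℝ) else 0 := by
    ext q r
    by_cases hq : q ∈ Set.range d.sample
    · obtain ⟨j, rfl⟩ := hq
      simp only [M, Matrix.mul_apply, Matrix.of_apply, Matrix.transpose_apply,
        d.sample.injective.eq_iff, ite_mul, one_mul, zero_mul, Finset.sum_ite_eq, Finset.mem_univ,
        if_true, Matrix.diagonal_apply, Set.mem_range_self]
      simp [eq_comm]
    · have hq' : ∀ j, q ≠ d.sample j := fun j hj => hq ⟨j, hj.symm⟩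
      simp only [M, Matrix.mul_apply, Matrix.of_apply, hq', if_false, zero_mul,
        Finset.sum_const_zero, Matrix.diagonal_apply, hq, ite_self]
  ext i q
  simp [hdiag, mask, Matrix.mul_diagonal]

theorem hadamard_one_sub_mask (d : FusionData h w Lh Lm Ls nh)
    (A : Matrix (Fin Ls) (Pixel h w) ℝ) :
    Matrix.hadamard A (Matrix.of (fun _ _ => (1 : ℝ)) - d.mask) = A - A * (d.M * d.Mᵀ) := by
  rw [← hadamard_mask]
  ext i q
  simp [mul_sub]

theorem isUnit_det_gram_add {m n : Type*} [Fintype m] [Fintype n] [DecidableEq n]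
    (A : Matrix m n ℝ) {c r : ℝ} (hc : 0 ≤ c) (hr : 0 < r) :
    IsUnit (c • (Aᵀ * A) + r • (1 : Matrix n n ℝ)).det := by
  have := (Matrix.posSemidef_conjTranspose_mul_self A).smul hc
  rw [Matrix.conjTranspose_eq_transpose_of_trivial] at this
  exact isUnit_det_of_posDef (Matrix.PosDef.posSemidef_add this (posDef_smul_one hr))

/-- The normal equation of the first proximal subproblem, at the point `Z = X B - D_1`. -/
def NormalV1 (d : FusionData h w Lh Lm Ls nh) (V Z : Matrix (Fin Ls) (Pixel h w) ℝ) : Prop :=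
  d.Eᵀ * (d.E * V * d.M - d.Yh) * d.Mᵀ = d.rho • (Z - V)

/-- The normal equation of the second proximal subproblem, at the point `Z = X - D_2`. -/
def NormalV2 (d : FusionData h w Lh Lm Ls nh) (V Z : Matrix (Fin Ls) (Pixel h w) ℝ) : Prop :=
  d.lam • ((d.R * d.E)ᵀ * (d.R * d.E * V - d.Ym)) = d.rho • (Z - V)

theorem normalV1_v1Update (d : FusionData h w Lh Lm Ls nh) (hrho : 0 < d.rho)
    (X D : Matrix (Fin Ls) (Pixel h w) ℝ) : d.NormalV1 (d.v1Update X D) (X * d.B - D) := by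
  have hA : IsUnit (d.Eᵀ * d.E + d.rho • (1 : Matrix (Fin Ls) (Fin Ls) ℝ)).det := by
    simpa using isUnit_det_gram_add d.E zero_le_one hrho
  set Z := X * d.B - D with hZ
  set A := d.Eᵀ * d.E + d.rho • (1 : Matrix (Fin Ls) (Fin Ls) ℝ) with hAdef
  set S := A⁻¹ * (d.Eᵀ * (d.Yh * d.Mᵀ) + d.rho • Z) with hS
  have hV : d.v1Update X D = S * (d.M * d.Mᵀ) + (Z - Z * (d.M * d.Mᵀ)) := by
    rw [v1Update, hadamard_mask, hadamard_one_sub_mask]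
  have hMM : d.M * d.Mᵀ * d.M = d.M := by
    rw [Matrix.mul_assoc, M_transpose_mul_M, Matrix.mul_one]
  -- On sampled columns the update agrees with the solution S of the full-grid system; elsewhere it
  -- equals Z, where the data term has no gradient.
  have hVM : d.v1Update X D * d.M = S * d.M := by
    rw [hV]
    simp only [Matrix.add_mul, Matrix.sub_mul, Matrix.mul_assoc S, Matrix.mul_assoc Z, hMM]
    abel
  have hAS : d.Eᵀ * d.E * S = d.Eᵀ * (d.Yh * d.Mᵀ) + d.rho • Z - d.rho • S := by
    have : A * S = d.Eᵀ * (d.Yh * d.Mᵀ) + d.rho • Z := by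
      rw [hS, ← Matrix.mul_assoc, Matrix.mul_nonsing_inv _ hA, Matrix.one_mul]
    rw [← this, hAdef, Matrix.add_mul, Matrix.smul_mul, Matrix.one_mul, add_sub_cancel_right]
  have hYM : d.Yh * d.Mᵀ * d.M = d.Yh := by
    rw [Matrix.mul_assoc, M_transpose_mul_M, Matrix.mul_one]
  have h1 : d.Eᵀ * (d.E * d.v1Update X D * d.M - d.Yh) = d.rho • (Z * d.M - S * d.M) := by
    calc _ = d.Eᵀ * d.E * S * d.M - d.Eᵀ * d.Yh := by
          rw [Matrix.mul_assoc d.E, hVM, Matrix.mul_sub]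
          simp only [Matrix.mul_assoc]
      _ = _ := by
          rw [hAS, Matrix.sub_mul, Matrix.add_mul, Matrix.mul_assoc d.Eᵀ, hYM, Matrix.smul_mul,
            Matrix.smul_mul, smul_sub]
          abel
  rw [NormalV1, h1, hV, Matrix.smul_mul, Matrix.sub_mul, Matrix.mul_assoc, Matrix.mul_assoc]
  congr 1
  abel

omit [NeZero h] [NeZero w] in
theorem normalV2_v2Update (d : FusionData h w Lh Lm Ls nh) (hrho : 0 < d.rho)
    (hlam : 0 ≤ d.lam) (X D : Matrix (Fin Ls) (Pixel h w) ℝ) :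
    d.NormalV2 (d.v2Update X D) (X - D) := by
  have hA := isUnit_det_gram_add (d.R * d.E) hlam hrho
  have hV : d.v2Update X D =
      (d.lam • ((d.R * d.E)ᵀ * (d.R * d.E)) + d.rho • (1 : Matrix (Fin Ls) (Fin Ls) ℝ))⁻¹ *
        (d.lam • ((d.R * d.E)ᵀ * d.Ym) + d.rho • (X - D)) := by
    rw [v2Update, Matrix.transpose_mul]
    simp only [Matrix.mul_assoc]
  set V := d.v2Update X D
  have h1 : (d.lam • ((d.R * d.E)ᵀ * (d.R * d.E)) + d.rho • (1 : Matrix (Fin Ls) (Fin Ls) ℝ)) * V =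
      d.lam • ((d.R * d.E)ᵀ * d.Ym) + d.rho • (X - D) := by
    rw [hV, ← Matrix.mul_assoc, Matrix.mul_nonsing_inv _ hA, Matrix.one_mul]
  rw [Matrix.add_mul, Matrix.smul_mul, Matrix.smul_mul, Matrix.one_mul] at h1
  rw [NormalV2, Matrix.mul_sub, ← Matrix.mul_assoc, smul_sub, smul_sub, sub_eq_sub_iff_add_eq_add,
    h1]
  abel

theorem xUpdate_normal (d : FusionData h w Lh Lm Ls nh) (s : SalsaState h w Ls) :
    (d.xUpdate s * d.B - s.V1 - s.D1) * d.Bᵀ + (d.xUpdate s - s.V2 - s.D2) +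
      (d.xUpdate s - s.V3 - s.D3) = 0 := by
  have hA : IsUnit (d.B * d.Bᵀ + (2 : ℝ) • (1 : Matrix (Pixel h w) (Pixel h w) ℝ)).det := by
    simpa using isUnit_det_gram_add d.Bᵀ zero_le_one zero_lt_two
  have h1 : d.xUpdate s * (d.B * d.Bᵀ + (2 : ℝ) • (1 : Matrix (Pixel h w) (Pixel h w) ℝ)) =
      (s.V1 + s.D1) * d.Bᵀ + s.V2 + s.D2 + s.V3 + s.D3 := by
    rw [xUpdate, Matrix.mul_assoc, Matrix.nonsing_inv_mul _ hA, Matrix.mul_one]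
  rw [Matrix.mul_add, Matrix.mul_smul, Matrix.mul_one, Matrix.add_mul, ← Matrix.mul_assoc,
    two_smul] at h1
  rw [Matrix.sub_mul, Matrix.sub_mul]
  rw [← sub_eq_zero] at h1
  rw [← h1]
  abel

/-- The resolvent of the first data term is firmly nonexpansive. -/
theorem NormalV1.firm {d : FusionData h w Lh Lm Ls nh} (hrho : 0 < d.rho)
    {V Z V' Z' : Matrix (Fin Ls) (Pixel h w) ℝ} (h1 : d.NormalV1 V Z) (h2 : d.NormalV1 V' Z') :
    0 ≤ frobInner (V - V') ((Z - Z') - (V - V')) := by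
  -- Subtracting the two normal equations and pairing with V − V' leaves the squared norm of the
  -- linear part of the data term.
  have h3 : d.rho * frobInner (Z - Z' - (V - V')) (V - V') = frobSq (d.E * (V - V') * d.M) := by
    rw [← frobInner_self, ← frobInner_smul_left]
    have : d.rho • (Z - Z' - (V - V')) = d.Eᵀ * (d.E * (V - V') * d.M) * d.Mᵀ := by
      rw [NormalV1] at h1 h2
      rw [show Z - Z' - (V - V') = (Z - V) - (Z' - V') by abel, smul_sub, ← h1, ← h2]
      simp only [Matrix.mul_sub, Matrix.sub_mul]
      abel
    rw [this, frobInner_mul_transpose_left, frobInner_transpose_mul_left, Matrix.mul_assoc d.E]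
  rw [frobInner_comm]
  exact nonneg_of_mul_nonneg_right (h3 ▸ frobSq_nonneg _) hrho

/-- The resolvent of the second data term is firmly nonexpansive. -/
theorem NormalV2.firm {d : FusionData h w Lh Lm Ls nh} (hrho : 0 < d.rho) (hlam : 0 ≤ d.lam)
    {V Z V' Z' : Matrix (Fin Ls) (Pixel h w) ℝ} (h1 : d.NormalV2 V Z) (h2 : d.NormalV2 V' Z') :
    0 ≤ frobInner (V - V') ((Z - Z') - (V - V')) := by
  have h3 : d.rho * frobInner (Z - Z' - (V - V')) (V - V') =
      d.lam * frobSq (d.R * d.E * (V - V')) := by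
    rw [← frobInner_self, ← frobInner_smul_left]
    have : d.rho • (Z - Z' - (V - V')) =
        d.lam • ((d.R * d.E)ᵀ * (d.R * d.E * (V - V'))) := by
      rw [NormalV2] at h1 h2
      rw [show Z - Z' - (V - V') = (Z - V) - (Z' - V') by abel, smul_sub, ← h1, ← h2, ← smul_sub]
      simp only [Matrix.mul_sub]
      abel_nf
    rw [this, frobInner_smul_left, frobInner_transpose_mul_left]
  rw [frobInner_comm]
  exact nonneg_of_mul_nonneg_right (h3 ▸ mul_nonneg hlam (frobSq_nonneg _)) hrho

/-- Firmness at equal inputs forces equal outputs; this gives uniqueness for the normal equations.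
-/
theorem eq_of_firm {m n : Type*} [Fintype m] [Fintype n] {V V' Z : Matrix m n ℝ}
    (hf : 0 ≤ frobInner (V - V') ((Z - Z) - (V - V'))) : V = V' := by
  rw [sub_self, frobInner_sub_right, frobInner_zero_right, frobInner_self, zero_sub] at hf
  exact sub_eq_zero.1 (frobSq_eq_zero.1 (le_antisymm (by linarith) (frobSq_nonneg _)))

end Updates

/-! ### The quadratic updates as unique minimizers. -/

section Argmin

variable {d : FusionData h w Lh Lm Ls nh}

theorem isArgmin_xUpdate (s : SalsaState h w Ls) :
    IsArgmin (fun X : Matrix (Fin Ls) (Pixel h w) ℝ =>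
      frobSq (X * d.B - s.V1 - s.D1) + frobSq (X - s.V2 - s.D2) + frobSq (X - s.V3 - s.D3))
      (d.xUpdate s) := by
  intro Y hY
  have hn := xUpdate_normal d s
  set X := d.xUpdate s
  obtain ⟨U, rfl⟩ : ∃ U, Y = X + U := ⟨Y - X, by abel⟩
  have hU : U ≠ 0 := fun h0 => hY (by simp [h0])
  -- The first-order term in U vanishes by the normal equation; the remaining quadratic part is
  -- positive for U ≠ 0.
  have h0 : frobInner (X * d.B - s.V1 - s.D1) (U * d.B) + frobInner (X - s.V2 - s.D2) U +
      frobInner (X - s.V3 - s.D3) U = 0 := by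
    rw [← frobInner_mul_transpose_left, ← frobInner_add_left, ← frobInner_add_left, hn,
      frobInner_zero_left]
  have e1 : (X + U) * d.B - s.V1 - s.D1 = (X * d.B - s.V1 - s.D1) + U * d.B := by
    rw [Matrix.add_mul]; abel
  have e2 : X + U - s.V2 - s.D2 = (X - s.V2 - s.D2) + U := by abel
  have e3 : X + U - s.V3 - s.D3 = (X - s.V3 - s.D3) + U := by abel
  simp only [e1, e2, e3, frobSq_add]
  linarith [frobSq_pos hU, frobSq_nonneg (U * d.B)]

theorem NormalV1.isArgmin (hrho : 0 < d.rho) {V Z D : Matrix (Fin Ls) (Pixel h w) ℝ}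
    (hn : d.NormalV1 V (Z - D)) :
    IsArgmin (fun V : Matrix (Fin Ls) (Pixel h w) ℝ =>
      frobSq (d.E * V * d.M - d.Yh) + d.rho * frobSq (Z - V - D)) V := by
  intro Y hY
  obtain ⟨U, rfl⟩ : ∃ U, Y = V + U := ⟨Y - V, by abel⟩
  have hU : U ≠ 0 := fun h0 => hY (by simp [h0])
  have h0 : frobInner (d.E * V * d.M - d.Yh) (d.E * U * d.M) =
      d.rho * frobInner (Z - D - V) U := by
    rw [← frobInner_smul_left, ← hn, frobInner_mul_transpose_left, frobInner_transpose_mul_left,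
      Matrix.mul_assoc d.E U]
  have e1 : d.E * (V + U) * d.M - d.Yh = (d.E * V * d.M - d.Yh) + d.E * U * d.M := by
    rw [Matrix.mul_add, Matrix.add_mul]; abel
  have e2 : Z - (V + U) - D = (Z - D - V) + (-1 : ℝ) • U := by rw [neg_one_smul]; abel
  have e3 : Z - V - D = Z - D - V := by abel
  have e4 : frobSq ((-1 : ℝ) • U) = frobSq U := by simp [frobSq]
  simp only [e1, e2, e3, frobSq_add, frobInner_smul_right, e4, h0]
  nlinarith [mul_pos hrho (frobSq_pos hU), frobSq_nonneg (d.E * U * d.M)]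

theorem NormalV2.isArgmin (hrho : 0 < d.rho) (hlam : 0 ≤ d.lam)
    {V Z D : Matrix (Fin Ls) (Pixel h w) ℝ} (hn : d.NormalV2 V (Z - D)) :
    IsArgmin (fun V : Matrix (Fin Ls) (Pixel h w) ℝ =>
      d.lam * frobSq (d.R * d.E * V - d.Ym) + d.rho * frobSq (Z - V - D)) V := by
  intro Y hY
  obtain ⟨U, rfl⟩ : ∃ U, Y = V + U := ⟨Y - V, by abel⟩
  have hU : U ≠ 0 := fun h0 => hY (by simp [h0])
  have h0 : d.lam * frobInner (d.R * d.E * V - d.Ym) (d.R * d.E * U) =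
      d.rho * frobInner (Z - D - V) U := by
    rw [← frobInner_smul_left d.rho, ← hn, frobInner_smul_left, frobInner_transpose_mul_left]
  have e1 : d.R * d.E * (V + U) - d.Ym = (d.R * d.E * V - d.Ym) + d.R * d.E * U := by
    rw [Matrix.mul_add]; abel
  have e2 : Z - (V + U) - D = (Z - D - V) + (-1 : ℝ) • U := by rw [neg_one_smul]; abel
  have e3 : Z - V - D = Z - D - V := by abel
  have e4 : frobSq ((-1 : ℝ) • U) = frobSq U := by simp [frobSq]
  simp only [e1, e2, e3, frobSq_add, frobInner_smul_right, e4]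
  nlinarith [mul_pos hrho (frobSq_pos hU), mul_nonneg hlam (frobSq_nonneg (d.R * d.E * U))]

end Argmin

end FusionData

/-! ### The denoiser as a proximity operator. -/

section Prox

variable {ι L : Type*} [Fintype ι] [DecidableEq ι] [Fintype L]

theorem ereal_mul_phiBands_mul {W : Matrix ι ι ℝ} (hW : W.IsHermitian) (c : ℝ)
    (Z : Matrix L ι ℝ) : (c : EReal) * phiBands W hW (Z * W) =
      ((c * ((frobInner Z (Z * W) - frobSq (Z * W)) / 2) : ℝ) : EReal) := by
  rw [phiBands_mul, EReal.coe_mul]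

/-- The matrix `W` is the proximity operator of `φ_W`. -/
theorem isArgmin_phiBands {W : Matrix ι ι ℝ} (hW : W.IsHermitian)
    (hfirm : ∀ z, (W *ᵥ z) ⬝ᵥ (W *ᵥ z) ≤ z ⬝ᵥ (W *ᵥ z)) {c : ℝ} (hc : 0 < c)
    (Z : Matrix L ι ℝ) :
    IsArgmin (fun V : Matrix L ι ℝ => (c : EReal) * phiBands W hW V
      + ((c / 2 * frobSq (Z - V) : ℝ) : EReal)) (Z * W) := by
  have hT : Wᵀ = W := by rwa [← Matrix.conjTranspose_eq_transpose_of_trivial]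
  intro V hV
  simp only [ereal_mul_phiBands_mul, ← EReal.coe_add]
  by_cases hVW : ∃ Y : Matrix L ι ℝ, V = Y * W
  · obtain ⟨Y, rfl⟩ := hVW
    rw [ereal_mul_phiBands_mul, ← EReal.coe_add, EReal.coe_lt_coe_iff]
    -- The excess over the value at ZW is exactly (c/2)⟨U, UW⟩ ≥ (c/2)‖UW‖², which is positive
    -- because V ≠ ZW.
    obtain ⟨U, rfl⟩ : ∃ U, Y = Z + U := ⟨Y - Z, by abel⟩
    have hU : U * W ≠ 0 := fun h0 => hV (by rw [Matrix.add_mul, h0, add_zero])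
    have hpos := (frobSq_pos hU).trans_le (frobSq_mul_le hW hfirm U)
    have hsymm : frobInner U (Z * W) = frobInner Z (U * W) := by
      rw [← frobInner_mul_transpose_left, hT, frobInner_comm]
    have e : Z - (Z + U) * W = (Z - Z * W) + (-1 : ℝ) • (U * W) := by
      rw [Matrix.add_mul, neg_one_smul]; abel
    have e4 : frobSq ((-1 : ℝ) • (U * W)) = frobSq (U * W) := by simp [frobSq]
    rw [e, Matrix.add_mul, frobSq_add, frobSq_add, frobInner_smul_right, frobInner_add_left,
      frobInner_add_right, frobInner_add_right, frobInner_sub_left, hsymm, e4]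
    nlinarith [mul_pos hc hpos]
  · rw [phiBands_eq_top hW hfirm hVW, EReal.coe_mul_top_of_pos hc,
      EReal.top_add_of_ne_bot (EReal.coe_ne_bot _)]
    exact EReal.coe_lt_top _

end Prox
end

noncomputable section
namespace FusionData

variable {h w Lh Lm Ls nh : ℕ} [NeZero h] [NeZero w]

/-! ### Existence and characterization of solutions. -/

section Optimality

/-- The gradient of the data terms of the fusion problem. -/
def dataGradient (d : FusionData h w Lh Lm Ls nh) (X : Matrix (Fin Ls) (Pixel h w) ℝ) :
    Matrix (Fin Ls) (Pixel h w) ℝ :=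
  d.Eᵀ * (d.E * X * d.B * d.M - d.Yh) * d.Mᵀ * d.Bᵀ
    + d.lam • ((d.R * d.E)ᵀ * (d.R * d.E * X - d.Ym))

theorem frobInner_dataGradient (d : FusionData h w Lh Lm Ls nh)
    (X U : Matrix (Fin Ls) (Pixel h w) ℝ) :
    frobInner (d.dataGradient X) U =
      frobInner (d.E * X * d.B * d.M - d.Yh) (d.E * U * d.B * d.M)
        + d.lam * frobInner (d.R * d.E * X - d.Ym) (d.R * d.E * U) := by
  rw [dataGradient, frobInner_add_left, frobInner_mul_transpose_left,
    frobInner_mul_transpose_left, frobInner_transpose_mul_left, frobInner_smul_left,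
    frobInner_transpose_mul_left, Matrix.mul_assoc d.E U, Matrix.mul_assoc d.E (U * d.B)]

/-- Stationarity of the fusion objective along `Z ↦ Z W`, the regularizer having weight `κ`. -/
def IsCritical (d : FusionData h w Lh Lm Ls nh) (W : Matrix (Pixel h w) (Pixel h w) ℝ) (κ : ℝ)
    (Z : Matrix (Fin Ls) (Pixel h w) ℝ) : Prop :=
  (d.dataGradient (Z * W) + κ • (Z - Z * W)) * W = 0

variable {W : Matrix (Pixel h w) (Pixel h w) ℝ}

/-- Stationarity is a linear system β(Z, ·) = f with β symmetric and positive semidefinite. On the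
radical all three nonnegative parts of β(Z, Z) vanish, hence so does f. -/
theorem exists_isCritical (d : FusionData h w Lh Lm Ls nh) (hlam : 0 ≤ d.lam) (hT : Wᵀ = W)
    (hfirm : ∀ Z : Matrix (Fin Ls) (Pixel h w) ℝ, frobSq (Z * W) ≤ frobInner Z (Z * W))
    {κ : ℝ} (hκ : 0 ≤ κ) : ∃ Z, d.IsCritical W κ Z := by
  have hsymm : ∀ Z U : Matrix (Fin Ls) (Pixel h w) ℝ,
      frobInner U (Z * W) = frobInner Z (U * W) := fun Z U => by
    rw [← frobInner_mul_transpose_left, hT, frobInner_comm]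
  let β : Matrix (Fin Ls) (Pixel h w) ℝ →ₗ[ℝ] Matrix (Fin Ls) (Pixel h w) ℝ →ₗ[ℝ] ℝ :=
    LinearMap.mk₂ ℝ (fun Z U =>
      frobInner (d.E * (Z * W) * d.B * d.M) (d.E * (U * W) * d.B * d.M)
        + d.lam * frobInner (d.R * d.E * (Z * W)) (d.R * d.E * (U * W))
        + κ * (frobInner Z (U * W) - frobInner (Z * W) (U * W)))
      (fun Z Z' U => by
        simp only [Matrix.add_mul, Matrix.mul_add, frobInner_add_left]; ring)
      (fun c Z U => by
        simp only [Matrix.smul_mul, Matrix.mul_smul, frobInner_smul_left, smul_eq_mul]; ring)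
      (fun Z U U' => by
        simp only [Matrix.add_mul, Matrix.mul_add, frobInner_add_right]; ring)
      (fun c Z U => by
        simp only [Matrix.smul_mul, Matrix.mul_smul, frobInner_smul_right, smul_eq_mul]; ring)
  let f : Matrix (Fin Ls) (Pixel h w) ℝ →ₗ[ℝ] ℝ :=
    { toFun := fun U => frobInner d.Yh (d.E * (U * W) * d.B * d.M)
        + d.lam * frobInner d.Ym (d.R * d.E * (U * W))
      map_add' := fun U U' => by
        simp only [Matrix.add_mul, Matrix.mul_add, frobInner_add_right]; ring
      map_smul' := fun c U => by
        simp only [Matrix.smul_mul, Matrix.mul_smul, frobInner_smul_right, smul_eq_mul,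
          RingHom.id_apply]
        ring }
  obtain ⟨Z, hZ⟩ := exists_eq_of_vanishes_on_ker β
    (fun Z U => by
      simp only [β, LinearMap.mk₂_apply, hsymm U Z, frobInner_comm (d.E * (Z * W) * d.B * d.M),
        frobInner_comm (d.R * d.E * (Z * W)), frobInner_comm (Z * W)])
    f (fun Z hZ => by
      have h0 : β Z Z = 0 := by rw [hZ]; rfl
      simp only [β, LinearMap.mk₂_apply, frobInner_self] at h0
      have p1 := frobSq_nonneg (d.E * (Z * W) * d.B * d.M)
      have p2 := mul_nonneg hlam (frobSq_nonneg (d.R * d.E * (Z * W)))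
      have p3 := mul_nonneg hκ (sub_nonneg.2 (hfirm Z))
      have z1 := frobSq_eq_zero.1 (show frobSq (d.E * (Z * W) * d.B * d.M) = 0 by linarith)
      have z2 : d.lam * frobSq (d.R * d.E * (Z * W)) = 0 := by linarith
      simp only [f, LinearMap.coe_mk, AddHom.coe_mk, z1, frobInner_zero_right, zero_add]
      -- If λ = 0 the second data term is absent from f as well.
      rcases mul_eq_zero.1 z2 with hl | hl
      · rw [hl, zero_mul]
      · rw [frobSq_eq_zero.1 hl, frobInner_zero_right, mul_zero])
  refine ⟨Z, eq_zero_of_forall_frobInner fun U => ?_⟩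
  have hU : β Z U = f U := by rw [hZ]
  simp only [β, f, LinearMap.mk₂_apply, LinearMap.coe_mk, AddHom.coe_mk] at hU
  conv_lhs => rw [← hT]
  rw [frobInner_mul_transpose_left, hT, frobInner_add_left, frobInner_dataGradient,
    frobInner_smul_left, frobInner_sub_left, frobInner_sub_left, frobInner_sub_left]
  linarith

/-- Within the range of `W`, the objective at (Z + U)W exceeds that at ZW by a nonnegative quadratic
in U; outside the range it is `⊤`. -/
theorem IsCritical.isMinOn {d : FusionData h w Lh Lm Ls nh} (hlam : 0 ≤ d.lam)
    (htau : 0 < d.tau) (hW : W.IsHermitian)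
    (hfirm : ∀ z, (W *ᵥ z) ⬝ᵥ (W *ᵥ z) ≤ z ⬝ᵥ (W *ᵥ z)) {c : ℝ} (hc : 0 < c)
    {Z : Matrix (Fin Ls) (Pixel h w) ℝ} (hZ : d.IsCritical W (d.tau * c) Z) :
    IsMinOn (d.objective fun X => (c : EReal) * phiBands W hW X) Set.univ (Z * W) := by
  have hT : Wᵀ = W := by rwa [← Matrix.conjTranspose_eq_transpose_of_trivial]
  refine isMinOn_univ_iff.2 fun Y => ?_
  simp only [objective]
  by_cases hY : ∃ Z' : Matrix (Fin Ls) (Pixel h w) ℝ, Y = Z' * W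
  · obtain ⟨Z', rfl⟩ := hY
    obtain ⟨U, rfl⟩ : ∃ U, Z' = Z + U := ⟨Z' - Z, by abel⟩
    simp only [ereal_mul_phiBands_mul, ← EReal.coe_mul, ← EReal.coe_add, EReal.coe_le_coe_iff]
    have hU : frobInner ((d.dataGradient (Z * W) + (d.tau * c) • (Z - Z * W)) * Wᵀ) U = 0 := by
      rw [hT, hZ, frobInner_zero_left]
    rw [frobInner_mul_transpose_left, frobInner_add_left, frobInner_dataGradient,
      frobInner_smul_left, frobInner_sub_left Z] at hU
    have hsymm : frobInner U (Z * W) = frobInner Z (U * W) := by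
      rw [← frobInner_mul_transpose_left, hT, frobInner_comm]
    have e1 : d.E * ((Z + U) * W) * d.B * d.M - d.Yh =
        (d.E * (Z * W) * d.B * d.M - d.Yh) + d.E * (U * W) * d.B * d.M := by
      simp only [Matrix.add_mul, Matrix.mul_add]; abel
    have e2 : d.R * d.E * ((Z + U) * W) - d.Ym =
        (d.R * d.E * (Z * W) - d.Ym) + d.R * d.E * (U * W) := by
      simp only [Matrix.add_mul, Matrix.mul_add]; abel
    rw [e1, e2, Matrix.add_mul]
    simp only [frobSq_add, frobInner_add_left, frobInner_add_right, hsymm]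
    have p1 := frobSq_nonneg (d.E * (U * W) * d.B * d.M)
    have p2 := mul_nonneg hlam (frobSq_nonneg (d.R * d.E * (U * W)))
    have p3 := mul_nonneg (mul_pos htau hc).le (sub_nonneg.2 (frobSq_mul_le hW hfirm U))
    linarith
  · rw [phiBands_eq_top hW hfirm hY, EReal.coe_mul_top_of_pos hc, EReal.coe_mul_top_of_pos htau,
      EReal.add_top_of_ne_bot (EReal.coe_ne_bot _)]
    exact le_top

end Optimality

/-! ### Reduction to a Douglas-Rachford map and its fixed points. -/

section DouglasRachford

/-- The arguments `X B - D_1`, `X - D_2`, `X - D_3` of the three proximal steps, with the updated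
`X`. -/
def proxInput (d : FusionData h w Lh Lm Ls nh) (s : SalsaState h w Ls) :
    Matrix (Fin Ls) (Pixel h w) ℝ × Matrix (Fin Ls) (Pixel h w) ℝ ×
      Matrix (Fin Ls) (Pixel h w) ℝ :=
  (d.xUpdate s * d.B - s.D1, d.xUpdate s - s.D2, d.xUpdate s - s.D3)

/-- The split and dual variables produced by the proximal steps from their arguments `p`. -/
def proxState (d : FusionData h w Lh Lm Ls nh) (W : Matrix (Pixel h w) (Pixel h w) ℝ)
    (p : Matrix (Fin Ls) (Pixel h w) ℝ × Matrix (Fin Ls) (Pixel h w) ℝ ×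
      Matrix (Fin Ls) (Pixel h w) ℝ) : SalsaState h w Ls where
  -- A dummy value, which `xUpdate` never reads. Below, the arguments `0` and `-p` evaluate the
  -- proximal maps at `p`, since the updates see only XB − D₁ and X − D₂.
  X := 0
  V1 := d.v1Update 0 (-p.1)
  V2 := d.v2Update 0 (-p.2.1)
  V3 := p.2.2 * Wᵀ
  D1 := d.v1Update 0 (-p.1) - p.1
  D2 := d.v2Update 0 (-p.2.1) - p.2.1
  D3 := p.2.2 * Wᵀ - p.2.2

/-- The Douglas-Rachford map underlying the algorithm. -/
def drMap (d : FusionData h w Lh Lm Ls nh) (W : Matrix (Pixel h w) (Pixel h w) ℝ)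
    (p : Matrix (Fin Ls) (Pixel h w) ℝ × Matrix (Fin Ls) (Pixel h w) ℝ ×
      Matrix (Fin Ls) (Pixel h w) ℝ) :
    Matrix (Fin Ls) (Pixel h w) ℝ × Matrix (Fin Ls) (Pixel h w) ℝ ×
      Matrix (Fin Ls) (Pixel h w) ℝ :=
  d.proxInput (d.proxState W p)

theorem step_eq (d : FusionData h w Lh Lm Ls nh) (W : Matrix (Pixel h w) (Pixel h w) ℝ)
    (s : SalsaState h w Ls) :
    d.step W s = { d.proxState W (d.proxInput s) with X := d.xUpdate s } := by
  have e1 : ∀ X D : Matrix (Fin Ls) (Pixel h w) ℝ,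
      d.v1Update X D = d.v1Update 0 (-(X * d.B - D)) := fun X D => by simp [v1Update]
  have e2 : ∀ X D : Matrix (Fin Ls) (Pixel h w) ℝ,
      d.v2Update X D = d.v2Update 0 (-(X - D)) := fun X D => by simp [v2Update]
  simp only [step, proxState, proxInput, v3Update, SalsaState.mk.injEq, true_and, ← e1, ← e2]
  refine ⟨?_, ?_, ?_⟩ <;> abel

/-- State k + 1 comes from the k-th Douglas-Rachford point, except for its X, which was computed
from state k. -/
theorem iter_succ_eq (d : FusionData h w Lh Lm Ls nh) (W : Matrix (Pixel h w) (Pixel h w) ℝ)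
    (k : ℕ) : d.iter W (k + 1) =
      { d.proxState W ((d.drMap W)^[k] (d.proxInput (d.iter W 0))) with
        X := d.xUpdate (d.iter W k) } := by
  have hin : ∀ k, d.proxInput (d.iter W k) = (d.drMap W)^[k] (d.proxInput (d.iter W 0)) := by
    intro k
    induction k with
    | zero => rfl
    | succ k ih =>
      rw [Function.iterate_succ_apply', ← ih]
      change d.proxInput (d.step W (d.iter W k)) = _
      rw [step_eq]
      rfl
  rw [← hin]
  exact d.step_eq W _

theorem isSalsaStep_iter {d : FusionData h w Lh Lm Ls nh} (hrho : 0 < d.rho) (hlam : 0 ≤ d.lam)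
    (htau : 0 < d.tau) {W : Matrix (Pixel h w) (Pixel h w) ℝ} (hW : W.IsHermitian)
    (hfirm : ∀ z, (W *ᵥ z) ⬝ᵥ (W *ᵥ z) ≤ z ⬝ᵥ (W *ᵥ z)) (s : SalsaState h w Ls) :
    d.IsSalsaStep (fun X => ((d.rho / d.tau : ℝ) : EReal) * phiBands W hW X) s (d.step W s) where
  X_eq := isArgmin_xUpdate s
  V1_eq := (normalV1_v1Update d hrho _ _).isArgmin hrho
  V2_eq := (normalV2_v2Update d hrho hlam _ _).isArgmin hrho hlam
  V3_eq := by
    have hT : Wᵀ = W := by rwa [← Matrix.conjTranspose_eq_transpose_of_trivial]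
    have := isArgmin_phiBands hW hfirm (div_pos hrho htau) (d.xUpdate s - s.D3)
    have e : ∀ V : Matrix (Fin Ls) (Pixel h w) ℝ,
        d.xUpdate s - V - s.D3 = d.xUpdate s - s.D3 - V := fun V => by abel
    simp only [step, v3Update, hT, e, mul_comm (2 : ℝ), ← div_div]
    exact this
  D1_eq := rfl
  D2_eq := rfl
  D3_eq := rfl

/-- Add `frobSq_douglasRachford` over the three blocks: the terms from the proximal maps have the
right sign by firmness, and those from the X update cancel. -/
theorem drMap_firm {d : FusionData h w Lh Lm Ls nh} (hrho : 0 < d.rho) (hlam : 0 ≤ d.lam)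
    {W : Matrix (Pixel h w) (Pixel h w) ℝ} (hT : Wᵀ = W)
    (hfirm : ∀ Z : Matrix (Fin Ls) (Pixel h w) ℝ, frobSq (Z * W) ≤ frobInner Z (Z * W))
    (p p' : Matrix (Fin Ls) (Pixel h w) ℝ × Matrix (Fin Ls) (Pixel h w) ℝ ×
      Matrix (Fin Ls) (Pixel h w) ℝ) :
    let q := fun p : Matrix (Fin Ls) (Pixel h w) ℝ × Matrix (Fin Ls) (Pixel h w) ℝ ×
      Matrix (Fin Ls) (Pixel h w) ℝ => frobSq p.1 + frobSq p.2.1 + frobSq p.2.2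
    q (d.drMap W p - d.drMap W p') + q ((p - d.drMap W p) - (p' - d.drMap W p')) ≤ q (p - p') := by
  obtain ⟨p1, p2, p3⟩ := p
  obtain ⟨q1, q2, q3⟩ := p'
  have hx := d.xUpdate_normal (d.proxState W (p1, p2, p3))
  have hy := d.xUpdate_normal (d.proxState W (q1, q2, q3))
  simp only [drMap, proxInput, Prod.fst_sub, Prod.snd_sub]
  generalize d.xUpdate (d.proxState W (p1, p2, p3)) = x at hx ⊢
  generalize d.xUpdate (d.proxState W (q1, q2, q3)) = y at hy ⊢
  simp only [proxState, hT] at hx hy ⊢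
  have f1 := (by simpa using d.normalV1_v1Update hrho 0 (-p1) :
    d.NormalV1 (d.v1Update 0 (-p1)) p1).firm hrho
    (by simpa using d.normalV1_v1Update hrho 0 (-q1) : d.NormalV1 (d.v1Update 0 (-q1)) q1)
  have f2 := (by simpa using d.normalV2_v2Update hrho hlam 0 (-p2) :
    d.NormalV2 (d.v2Update 0 (-p2)) p2).firm hrho hlam
    (by simpa using d.normalV2_v2Update hrho hlam 0 (-q2) : d.NormalV2 (d.v2Update 0 (-q2)) q2)
  generalize d.v1Update 0 (-p1) = a1 at *
  generalize d.v1Update 0 (-q1) = b1 at *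
  generalize d.v2Update 0 (-p2) = a2 at *
  generalize d.v2Update 0 (-q2) = b2 at *
  have f3 : 0 ≤ frobInner (p3 * W - q3 * W) (p3 - q3 - (p3 * W - q3 * W)) := by
    have := hfirm (p3 - q3)
    rw [frobInner_sub_right, frobInner_self, ← Matrix.sub_mul, frobInner_comm]
    linarith
  generalize p3 * W = a3 at *
  generalize q3 * W = b3 at *
  -- The X update projects the reflected point 2a − p onto the range of X ↦ (XB, X, X), so the
  -- residual is orthogonal to that range.
  have hz : frobInner ((x - y) * d.B) ((a1 - b1) + ((a1 - b1) - (p1 - q1)) - (x - y) * d.B)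
      + frobInner (x - y) ((a2 - b2) + ((a2 - b2) - (p2 - q2)) - (x - y))
      + frobInner (x - y) ((a3 - b3) + ((a3 - b3) - (p3 - q3)) - (x - y)) = 0 := by
    rw [frobInner_comm ((x - y) * d.B), ← frobInner_mul_transpose_left, frobInner_comm (x - y),
      frobInner_comm (x - y), ← frobInner_add_left, ← frobInner_add_left]
    convert frobInner_zero_left (x - y) using 2
    rw [← sub_self (0 : Matrix (Fin Ls) (Pixel h w) ℝ)]
    nth_rewrite 1 [← hy]
    rw [← hx]
    simp only [Matrix.sub_mul, Matrix.add_mul]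
    abel
  have i1 := frobSq_douglasRachford (p1 - q1) (a1 - b1) ((x - y) * d.B)
  have i2 := frobSq_douglasRachford (p2 - q2) (a2 - b2) (x - y)
  have i3 := frobSq_douglasRachford (p3 - q3) (a3 - b3) (x - y)
  have e1 : x * d.B - (a1 - p1) - (y * d.B - (b1 - q1)) =
      (x - y) * d.B + (p1 - q1) - (a1 - b1) := by rw [Matrix.sub_mul]; abel
  have e1' : p1 - (x * d.B - (a1 - p1)) - (q1 - (y * d.B - (b1 - q1))) =
      (a1 - b1) - (x - y) * d.B := by rw [Matrix.sub_mul]; abel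
  have e2 : x - (a2 - p2) - (y - (b2 - q2)) = (x - y) + (p2 - q2) - (a2 - b2) := by abel
  have e2' : p2 - (x - (a2 - p2)) - (q2 - (y - (b2 - q2))) = (a2 - b2) - (x - y) := by abel
  have e3 : x - (a3 - p3) - (y - (b3 - q3)) = (x - y) + (p3 - q3) - (a3 - b3) := by abel
  have e3' : p3 - (x - (a3 - p3)) - (q3 - (y - (b3 - q3))) = (a3 - b3) - (x - y) := by abel
  rw [e1, e1', e2, e2', e3, e3']
  linarith

theorem drMap_fixed_of_isCritical {d : FusionData h w Lh Lm Ls nh} (hrho : 0 < d.rho)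
    (hlam : 0 ≤ d.lam) {W : Matrix (Pixel h w) (Pixel h w) ℝ} (hT : Wᵀ = W)
    {Z : Matrix (Fin Ls) (Pixel h w) ℝ} (hZ : d.IsCritical W d.rho Z) :
    ∃ p, d.drMap W p = p := by
  set X := Z * W with hX
  set G1 := d.Eᵀ * (d.E * X * d.B * d.M - d.Yh) * d.Mᵀ with hG1
  set G2 := d.lam • ((d.R * d.E)ᵀ * (d.R * d.E * X - d.Ym)) with hG2
  set G := d.dataGradient X with hG
  have hGsum : G = G1 * d.Bᵀ + G2 := rfl
  -- Each input is its intended output plus ρ⁻¹ times a gradient. The minus sign in `p3` balances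
  -- the dual variables, D₁Bᵀ + D₂ + D₃ = 0, so that the X update returns X.
  set p1 := X * d.B + d.rho⁻¹ • G1 with hp1
  set p2 := X + d.rho⁻¹ • G2 with hp2
  set p3 := X - d.rho⁻¹ • G with hp3
  have s1 : d.v1Update 0 (-p1) = X * d.B := by
    have n1 : d.NormalV1 (d.v1Update 0 (-p1)) p1 := by
      simpa using d.normalV1_v1Update hrho 0 (-p1)
    refine eq_of_firm (n1.firm hrho ?_)
    rw [NormalV1, hp1, add_sub_cancel_left, smul_inv_smul₀ hrho.ne', hG1, Matrix.mul_assoc d.E X]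
  have s2 : d.v2Update 0 (-p2) = X := by
    have n2 : d.NormalV2 (d.v2Update 0 (-p2)) p2 := by
      simpa using d.normalV2_v2Update hrho hlam 0 (-p2)
    refine eq_of_firm (n2.firm hrho hlam ?_)
    rw [NormalV2, hp2, add_sub_cancel_left, smul_inv_smul₀ hrho.ne']
  -- This is exactly the criticality of Z; `p3` itself may differ from Z by an element killed by
  -- `W`.
  have s3 : p3 * W = X := by
    have h0 : d.rho⁻¹ • ((G + d.rho • (Z - X)) * W) = 0 := by
      rw [show (G + d.rho • (Z - X)) * W = 0 from hZ, smul_zero]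
    rw [← Matrix.smul_mul, smul_add, inv_smul_smul₀ hrho.ne', Matrix.add_mul, Matrix.sub_mul,
      ← hX] at h0
    rw [hp3, Matrix.sub_mul, ← sub_eq_zero, ← neg_eq_zero, ← h0]
    abel
  clear_value p1 p2 p3
  refine ⟨(p1, p2, p3), ?_⟩
  have hs : d.proxState W (p1, p2, p3) =
      { X := 0, V1 := X * d.B, V2 := X, V3 := X, D1 := -(d.rho⁻¹ • G1), D2 := -(d.rho⁻¹ • G2),
        D3 := d.rho⁻¹ • G } := by
    simp only [proxState, s1, s2, hT, s3, SalsaState.mk.injEq, true_and]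
    rw [hp1, hp2, hp3]
    refine ⟨?_, ?_, ?_⟩ <;> abel
  have hx : d.xUpdate (d.proxState W (p1, p2, p3)) = X := by
    have hA : IsUnit (d.B * d.Bᵀ + (2 : ℝ) • (1 : Matrix (Pixel h w) (Pixel h w) ℝ)).det := by
      simpa using isUnit_det_gram_add d.Bᵀ zero_le_one zero_lt_two
    have h1 : (X * d.B + -(d.rho⁻¹ • G1)) * d.Bᵀ + X + -(d.rho⁻¹ • G2) + X + d.rho⁻¹ • G =
        X * (d.B * d.Bᵀ + (2 : ℝ) • (1 : Matrix (Pixel h w) (Pixel h w) ℝ)) := by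
      rw [hGsum, Matrix.mul_add, Matrix.mul_smul, Matrix.mul_one, two_smul, Matrix.add_mul,
        Matrix.neg_mul, Matrix.smul_mul, smul_add, Matrix.mul_assoc]
      abel
    rw [hs, xUpdate, h1, Matrix.mul_assoc, Matrix.mul_nonsing_inv _ hA, Matrix.mul_one]
  rw [drMap, proxInput, hx, hs]
  simp only [hp1, hp2, hp3, sub_neg_eq_add]

/-- A fixed point of the Douglas-Rachford map consists of a primal-dual solution. -/
theorem fixed_point_spec {d : FusionData h w Lh Lm Ls nh} (hrho : 0 < d.rho)
    (hlam : 0 ≤ d.lam) {W : Matrix (Pixel h w) (Pixel h w) ℝ} (hT : Wᵀ = W)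
    {p : Matrix (Fin Ls) (Pixel h w) ℝ × Matrix (Fin Ls) (Pixel h w) ℝ ×
      Matrix (Fin Ls) (Pixel h w) ℝ} (hp : d.drMap W p = p) :
    let X := d.xUpdate (d.proxState W p)
    (d.proxState W p).V1 = X * d.B ∧ (d.proxState W p).V2 = X ∧ (d.proxState W p).V3 = X ∧
      X = p.2.2 * W ∧ d.IsCritical W d.rho p.2.2 := by
  intro X
  obtain ⟨p1, p2, p3⟩ := p
  have hn := d.xUpdate_normal (d.proxState W (p1, p2, p3))
  have n1 : d.NormalV1 (d.v1Update 0 (-p1)) p1 := by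
    simpa using d.normalV1_v1Update hrho 0 (-p1)
  have n2 : d.NormalV2 (d.v2Update 0 (-p2)) p2 := by
    simpa using d.normalV2_v2Update hrho hlam 0 (-p2)
  change _ = _ at hp
  simp only [drMap, proxInput, Prod.mk.injEq] at hp
  change (X * d.B - _ - _) * _ + (X - _ - _) + (X - _ - _) = 0 at hn
  obtain ⟨h1, h2, h3⟩ := hp
  change X * d.B - _ = _ at h1
  change X - _ = _ at h2 h3
  clear_value X
  simp only [proxState, hT] at h1 h2 h3 hn ⊢
  generalize d.v1Update 0 (-p1) = a1 at *
  generalize d.v2Update 0 (-p2) = a2 at *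
  have g1 : a1 = X * d.B := by
    rw [← sub_eq_zero]
    rw [← sub_eq_zero, ← neg_eq_zero] at h1
    rw [← h1]; abel
  have g2 : a2 = X := by
    rw [← sub_eq_zero]
    rw [← sub_eq_zero, ← neg_eq_zero] at h2
    rw [← h2]; abel
  have g3 : p3 * W = X := by
    rw [← sub_eq_zero]
    rw [← sub_eq_zero, ← neg_eq_zero] at h3
    rw [← h3]; abel
  refine ⟨g1, g2, g3, g3.symm, ?_⟩
  rw [g1] at n1 hn
  rw [g2] at n2 hn
  rw [NormalV1, ← Matrix.mul_assoc] at n1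
  rw [NormalV2] at n2
  rw [g3] at hn
  rw [IsCritical, g3, dataGradient, n1, n2, Matrix.smul_mul, ← smul_add, ← smul_add]
  -- Once V = (XB, X, X), the normal equation of the X update says that the three residuals balance.
  have : (p1 - X * d.B) * d.Bᵀ + (p2 - X) + (p3 - X) = 0 := by
    rw [← hn]
    simp only [Matrix.sub_mul]
    abel
  rw [this, smul_zero, Matrix.zero_mul]

end DouglasRachford

/-! ### Convergence of the iterates. -/

section Convergence

theorem continuous_v1Update (d : FusionData h w Lh Lm Ls nh) :
    Continuous fun p : Matrix (Fin Ls) (Pixel h w) ℝ => d.v1Update 0 (-p) := by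
  simp only [v1Update, hadamard_mask, hadamard_one_sub_mask]
  fun_prop

omit [NeZero h] [NeZero w] in
theorem continuous_v2Update (d : FusionData h w Lh Lm Ls nh) :
    Continuous fun p : Matrix (Fin Ls) (Pixel h w) ℝ => d.v2Update 0 (-p) := by
  simp only [v2Update]
  fun_prop

theorem continuous_xUpdate_proxState (d : FusionData h w Lh Lm Ls nh)
    (W : Matrix (Pixel h w) (Pixel h w) ℝ) :
    Continuous fun p => d.xUpdate (d.proxState W p) := by
  have h1 := d.continuous_v1Update
  have h2 := d.continuous_v2Update
  simp only [xUpdate, proxState]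
  generalize hf1 : (fun p : Matrix (Fin Ls) (Pixel h w) ℝ => d.v1Update 0 (-p)) = f1 at h1
  generalize hf2 : (fun p : Matrix (Fin Ls) (Pixel h w) ℝ => d.v2Update 0 (-p)) = f2 at h2
  simp only [fun p => congrFun hf1 p, fun p => congrFun hf2 p]
  fun_prop

-- Convergence is measured in the entrywise sup norm, firmness in the Frobenius energy, which
-- dominates its square.
attribute [local instance] Matrix.normedAddCommGroup in
theorem exists_tendsto_drMap {d : FusionData h w Lh Lm Ls nh} (hrho : 0 < d.rho)
    (hlam : 0 ≤ d.lam) {W : Matrix (Pixel h w) (Pixel h w) ℝ} (hT : Wᵀ = W)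
    (hfirm : ∀ Z : Matrix (Fin Ls) (Pixel h w) ℝ, frobSq (Z * W) ≤ frobInner Z (Z * W))
    (p : Matrix (Fin Ls) (Pixel h w) ℝ × Matrix (Fin Ls) (Pixel h w) ℝ ×
      Matrix (Fin Ls) (Pixel h w) ℝ) :
    ∃ z, d.drMap W z = z ∧ Tendsto (fun k => (d.drMap W)^[k] p) atTop (𝓝 z) := by
  obtain ⟨Z, hZ⟩ := d.exists_isCritical hlam hT hfirm hrho.le
  obtain ⟨p0, hp0⟩ := drMap_fixed_of_isCritical hrho hlam hT hZ
  have : ProperSpace (Matrix (Fin Ls) (Pixel h w) ℝ) :=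
    inferInstanceAs (ProperSpace (Fin Ls → Pixel h w → ℝ))
  have hnorm : ∀ A : Matrix (Fin Ls) (Pixel h w) ℝ, ‖A‖ ^ 2 ≤ frobSq A := fun A => by
    rw [← Real.le_sqrt (norm_nonneg _) (frobSq_nonneg _), Matrix.norm_le_iff (Real.sqrt_nonneg _)]
    intro i j
    rw [Real.norm_eq_abs]
    exact Real.abs_le_sqrt (sq_apply_le_frobSq A i j)
  have hc : Continuous (frobSq : Matrix (Fin Ls) (Pixel h w) ℝ → ℝ) := continuous_frobSq
  let q : Matrix (Fin Ls) (Pixel h w) ℝ × Matrix (Fin Ls) (Pixel h w) ℝ ×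
    Matrix (Fin Ls) (Pixel h w) ℝ → ℝ := fun p => frobSq p.1 + frobSq p.2.1 + frobSq p.2.2
  have hq : Continuous q :=
    (hc.comp continuous_fst).add ((hc.comp (continuous_fst.comp continuous_snd))) |>.add
      (hc.comp (continuous_snd.comp continuous_snd))
  have hq0 : q 0 = 0 := by simp [q, frobSq]
  have hle : ∀ x, ‖x‖ ^ 2 ≤ q x := fun x => by
    have h1 := hnorm x.1
    have h2 := hnorm x.2.1
    have h3 := hnorm x.2.2
    have g1 := frobSq_nonneg x.1
    have g2 := frobSq_nonneg x.2.1
    have g3 := frobSq_nonneg x.2.2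
    simp only [q]
    rw [Prod.norm_def, Prod.norm_def]
    rcases max_choice ‖x.1‖ (max ‖x.2.1‖ ‖x.2.2‖) with hm | hm <;> rw [hm]
    · linarith
    · rcases max_choice ‖x.2.1‖ ‖x.2.2‖ with hm | hm <;> rw [hm] <;> linarith
  exact exists_tendsto_iterate_of_firmlyNonexpansive hq hq0 hle (drMap_firm hrho hlam hT hfirm)
    hp0 p

theorem exists_tendsto_iter {d : FusionData h w Lh Lm Ls nh} (hrho : 0 < d.rho)
    (hlam : 0 ≤ d.lam) {W : Matrix (Pixel h w) (Pixel h w) ℝ} (hT : Wᵀ = W)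
    (hfirm : ∀ Z : Matrix (Fin Ls) (Pixel h w) ℝ, frobSq (Z * W) ≤ frobInner Z (Z * W)) :
    ∃ Z Xs D1s D2s D3s : Matrix (Fin Ls) (Pixel h w) ℝ,
      d.IsCritical W d.rho Z ∧ Xs = Z * W ∧
      Tendsto (fun k => (d.iter W k).X) atTop (𝓝 Xs) ∧
      Tendsto (fun k => (d.iter W k).V1) atTop (𝓝 (Xs * d.B)) ∧
      Tendsto (fun k => (d.iter W k).V2) atTop (𝓝 Xs) ∧
      Tendsto (fun k => (d.iter W k).V3) atTop (𝓝 Xs) ∧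
      Tendsto (fun k => (d.iter W k).D1) atTop (𝓝 D1s) ∧
      Tendsto (fun k => (d.iter W k).D2) atTop (𝓝 D2s) ∧
      Tendsto (fun k => (d.iter W k).D3) atTop (𝓝 D3s) := by
  obtain ⟨p, hp, hlim⟩ := exists_tendsto_drMap hrho hlam hT hfirm (d.proxInput (d.iter W 0))
  obtain ⟨h1, h2, h3, hX, hcrit⟩ := fixed_point_spec hrho hlam hT hp
  have c1 := d.continuous_v1Update.comp (continuous_fst
    (Y := Matrix (Fin Ls) (Pixel h w) ℝ × Matrix (Fin Ls) (Pixel h w) ℝ))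
  have c2 := d.continuous_v2Update.comp ((continuous_fst
    (Y := Matrix (Fin Ls) (Pixel h w) ℝ)).comp (continuous_snd
    (X := Matrix (Fin Ls) (Pixel h w) ℝ)))
  -- Only quantities independent of the stored X are functions of the current Douglas-Rachford
  -- point, hence the invariance condition on F.
  have key : ∀ F : SalsaState h w Ls → Matrix (Fin Ls) (Pixel h w) ℝ,
      (∀ s X, F { s with X := X } = F s) → Continuous (fun p => F (d.proxState W p)) →
      Tendsto (fun k => F (d.iter W k)) atTop (𝓝 (F (d.proxState W p))) := by
    intro F hF hc
    rw [← tendsto_add_atTop_iff_nat 1]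
    simp only [iter_succ_eq, hF]
    exact (hc.tendsto p).comp hlim
  refine ⟨p.2.2, d.xUpdate (d.proxState W p), (d.proxState W p).D1, (d.proxState W p).D2,
    (d.proxState W p).D3, hcrit, hX, ?_, ?_, ?_, ?_, ?_, ?_, ?_⟩
  -- After a shift by one, X is `xUpdate` of the preceding state, which ignores the stored X.
  · rw [← tendsto_add_atTop_iff_nat 1]
    exact key d.xUpdate (fun _ _ => rfl) (d.continuous_xUpdate_proxState W)
  · rw [← h1]
    exact key SalsaState.V1 (fun _ _ => rfl) c1
  · conv => rhs; rw [← h2]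
    exact key SalsaState.V2 (fun _ _ => rfl) c2
  · conv => rhs; rw [← h3]
    exact key SalsaState.V3 (fun _ _ => rfl) (by simp only [proxState]; fun_prop)
  · exact key SalsaState.D1 (fun _ _ => rfl) (c1.sub continuous_fst)
  · exact key SalsaState.D2 (fun _ _ => rfl) (c2.sub (continuous_fst.comp continuous_snd))
  · exact key SalsaState.D3 (fun _ _ => rfl) (by simp only [proxState]; fun_prop)

end Convergence

end FusionData
end

/-! ### Assembly of the theorem. -/

/-- PnP-SALSA with a symmetric, firmly nonexpansive linear denoiser `W` is SALSA for the fusion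
problem regularized by `φ_W`, and converges to a solution. -/
theorem FusionData.salsa_converges {h w Lh Lm Ls nh : ℕ} [NeZero h] [NeZero w]
    (d : FusionData h w Lh Lm Ls nh) (hrho : 0 < d.rho) (hlam : 0 ≤ d.lam) (htau : 0 < d.tau)
    {W : Matrix (Pixel h w) (Pixel h w) ℝ} (hW : W.IsHermitian)
    (hfirm : ∀ z, (W *ᵥ z) ⬝ᵥ (W *ᵥ z) ≤ z ⬝ᵥ (W *ᵥ z)) :
    (∀ k, d.IsSalsaStep
        (fun X => ((d.rho / d.tau : ℝ) : EReal) * phiBands W hW X)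
        (d.iter W k) (d.iter W (k + 1))) ∧
    (∃ X, IsMinOn (d.objective (phiBands W hW)) Set.univ X) ∧
    (∃ X, IsMinOn
        (d.objective (fun X => ((d.rho / d.tau : ℝ) : EReal) * phiBands W hW X))
        Set.univ X) ∧
    (∃ Xs D1s D2s D3s : Matrix (Fin Ls) (Pixel h w) ℝ,
      IsMinOn
        (d.objective (fun X => ((d.rho / d.tau : ℝ) : EReal) * phiBands W hW X))
        Set.univ Xs ∧
      Tendsto (fun k => (d.iter W k).X) atTop (𝓝 Xs) ∧
      Tendsto (fun k => d.E * (d.iter W k).X) atTop (𝓝 (d.E * Xs)) ∧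
      Tendsto (fun k => (d.iter W k).V1) atTop (𝓝 (Xs * d.B)) ∧
      Tendsto (fun k => (d.iter W k).V2) atTop (𝓝 Xs) ∧
      Tendsto (fun k => (d.iter W k).V3) atTop (𝓝 Xs) ∧
      Tendsto (fun k => (d.iter W k).D1) atTop (𝓝 D1s) ∧
      Tendsto (fun k => (d.iter W k).D2) atTop (𝓝 D2s) ∧
      Tendsto (fun k => (d.iter W k).D3) atTop (𝓝 D3s)) := by
  have hT : Wᵀ = W := by rwa [← Matrix.conjTranspose_eq_transpose_of_trivial]
  have hfirm' := frobSq_mul_le (L := Fin Ls) hW hfirm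
  obtain ⟨Z, Xs, D1s, D2s, D3s, hZ, rfl, hX, hV1, hV2, hV3, hD1, hD2, hD3⟩ :=
    FusionData.exists_tendsto_iter hrho hlam hT hfirm'
  -- The fixed point has regularization weight ρ = τ · (ρ/τ), matching φ = (ρ/τ)φ_W.
  rw [← mul_div_cancel₀ d.rho htau.ne'] at hZ
  have hmin := hZ.isMinOn hlam htau hW hfirm (div_pos hrho htau)
  refine ⟨fun k => FusionData.isSalsaStep_iter hrho hlam htau hW hfirm _, ?_, ⟨_, hmin⟩,
    Z * W, D1s, D2s, D3s, hmin, hX, ?_, hV1, hV2, hV3, hD1, hD2, hD3⟩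
  -- For φ_W itself the weight is τ · 1, which needs a separate critical point.
  · obtain ⟨Z', hZ'⟩ := d.exists_isCritical hlam hT hfirm' (mul_pos htau one_pos).le
    have := hZ'.isMinOn hlam htau hW hfirm one_pos
    simp only [EReal.coe_one, one_mul] at this
    exact ⟨_, this⟩
  · have hc : Continuous fun X : Matrix (Fin Ls) (Pixel h w) ℝ => d.E * X := by fun_prop
    exact (hc.tendsto _).comp hX

theorem corollary3 {h w np K Lh Lm Ls nh : ℕ} [NeZero h] [NeZero w] [NeZero np]
    (d : FusionData h w Lh Lm Ls nh) (g : SceneGMM h w np K) (o : Fin np → Pixel h w)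
    (hrho : 0 < d.rho) (hlam : 0 ≤ d.lam) (htau : 0 < d.tau)
    (W : Matrix (Pixel h w) (Pixel h w) ℝ) (hW : W = gmmDenoiser g o (d.tau / d.rho))
    (φW φ : Matrix (Fin Ls) (Pixel h w) ℝ → EReal)
    (hφW : φW = phiBands (gmmDenoiser g o (d.tau / d.rho))
      (gmmDenoiser_isHermitian g o (d.tau / d.rho)))
    (hφ : φ = fun X => ((d.rho / d.tau : ℝ) : EReal) * φW X) :
    -- the algorithm is SALSA for the fusion problem, with the denoiser as proximity operator
    (∀ k, d.IsSalsaStep φ (d.iter W k) (d.iter W (k + 1))) ∧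
    -- the fusion problem has a solution, with either normalization of the regularizer
    (∃ X, IsMinOn (d.objective φW) Set.univ X) ∧
    (∃ X, IsMinOn (d.objective φ) Set.univ X) ∧
    -- the algorithm converges to a solution
    (∃ Xs D1s D2s D3s : Matrix (Fin Ls) (Pixel h w) ℝ,
      IsMinOn (d.objective φ) Set.univ Xs ∧
      Tendsto (fun k => (d.iter W k).X) atTop (𝓝 Xs) ∧
      Tendsto (fun k => d.E * (d.iter W k).X) atTop (𝓝 (d.E * Xs)) ∧
      Tendsto (fun k => (d.iter W k).V1) atTop (𝓝 (Xs * d.B)) ∧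
      Tendsto (fun k => (d.iter W k).V2) atTop (𝓝 Xs) ∧
      Tendsto (fun k => (d.iter W k).V3) atTop (𝓝 Xs) ∧
      Tendsto (fun k => (d.iter W k).D1) atTop (𝓝 D1s) ∧
      Tendsto (fun k => (d.iter W k).D2) atTop (𝓝 D2s) ∧
      Tendsto (fun k => (d.iter W k).D3) atTop (𝓝 D3s)) := by
  subst hφ hφW hW
  exact d.salsa_converges hrho hlam htau (gmmDenoiser_isHermitian g o (d.tau / d.rho))
    (gmmDenoiser_firm g o (div_pos htau hrho))
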